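/- Let $A\in\mathbb{C}^{n\times n}$ and $\varepsilon>0$. Write $\mathrm{eig}(M)$ for the spectrum of a matrix (or operator) $M$, $\rho(M)=\mathbb{C}\setminus\mathrm{eig}(M)$, $\|\cdot\|_2$ for the spectral norm, $\mathbb{D}=\{t\in\mathbb{C}:|t|\le 1\}$, and let $$\mathrm{eig}_\varepsilon(A)=\bigcup_{\|E\|_2\le\varepsilon}\mathrm{eig}(A+E)$$ be the $\varepsilon$-pseudospectrum of $A$. A Cauchy contour $\Gamma$ is the oriented boundary of a bounded open set $\mathrm{Int}(\Gamma)\subset\mathbb{C}$ that has finitely many connected components, with pairwise disjoint closures, and whose boundary consists of finitely many pairwise disjoint rectifiable closed Jordan curves, oriented so that $\Gamma$ has total winding number $1$ about each point of $\mathrm{Int}(\Gamma)$ and $0$ about each point of $\mathrm{Ext}(\Gamma):=\mathbb{C}\setminus\overline{\mathrm{Int}(\Gamma)}$. Let $\Delta_1,\dots,\Delta_m$ be connected components of $\mathrm{eig}_\varepsilon(A)$, and put $\Delta:=\bigcup_{j=1}^m\Delta_j$ and $\Delta_e:=\mathrm{eig}_\varepsilon(A)\setminus\Delta$. Then: 1.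 $\Delta$ and $\Delta_e$ are disjoint compact sets and $\mathrm{eig}_\varepsilon(A)=\Delta\cup\Delta_e$. 2. There exists a Cauchy contour $\Gamma$ with $\Delta\subset\mathrm{Int}(\Gamma)$ and $\Delta_e\subset\mathrm{Ext}(\Gamma)$. 3. Let $\Gamma$ be any Cauchy contour with $\Delta\subset\mathrm{Int}(\Gamma)$ and $\Delta_e\subset\mathrm{Ext}(\Gamma)$, and let $E\in\mathbb{C}^{n\times n}$ with $\|E\|_2=\varepsilon$. Then $\Gamma\subset\rho(A+tE)$ for all $t\in\mathbb{D}$. Put $$P:=\frac{-1}{2\pi i}\int_\Gamma(A-zI)^{-1}\,dz,\qquad P(t):=\frac{-1}{2\pi i}\int_\Gamma(A+tE-zI)^{-1}\,dz .$$ Then $t\mapsto P(t)$ is analytic on (a neighbourhood of each point of) $\mathbb{D}$ and, for all $t\in\mathbb{D}$, $P(t)$ is a projection that commutes with $A+tE$ and $\mathrm{rank}(P(t))=\mathrm{rank}(P)$. Let $A_Y(t)$ and $A_Z(t)$ be the restrictions of $A+tE$ to the range and to the null space of $P(t)$, which are invariant under $A+tE$. For all $t\in\mathbb{D}$, $\mathrm{eig}(A+tE)=\mathrm{eig}(A_Y(t))\cup\mathrm{eig}(A_Z(t))$,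 $$\mathrm{eig}(A_Y(t))=\mathrm{eig}(A+tE)\cap\mathrm{Int}(\Gamma)\subset\Delta,\qquad \mathrm{eig}(A_Z(t))=\mathrm{eig}(A+tE)\cap\mathrm{Ext}(\Gamma)\subset\Delta_e .$$ 4. For every $E\in\mathbb{C}^{n\times n}$ with $\|E\|_2=\varepsilon$ and every $t\in\mathbb{D}$, $\Delta$ contains the same number of eigenvalues, counted with algebraic multiplicity, of $A$ and of $A+tE$. 5. Let $E\in\mathbb{C}^{n\times n}$ with $\|E\|_2=\varepsilon$, let $S\subset\mathbb{D}$ be a connected set containing $0$ (for instance $S=\mathbb{D}$ or $S=[0,1]$), and let $\lambda:S\to\mathbb{C}$ be continuous with $\lambda(t)\in\mathrm{eig}(A+tE)$ for all $t\in S$. If $\lambda(0)\in\Delta$, then $\lambda(t)\in\Delta$ for all $t\in S$; if $\lambda(0)\in\Delta_e$, then $\lambda(t)\in\Delta_e$ for all $t\in S$. -/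

import Mathlib

open scoped Matrix.Norms.L2Operator

namespace SpectralPerturbation

/-- The `ε`-pseudospectrum of `A`: the union of the spectra of `A + E` over all `E` with
`‖E‖₂ ≤ ε`, where `‖·‖₂` is the spectral norm (the Euclidean operator norm). -/
def pseudospectrum {n : ℕ} (A : Matrix (Fin n) (Fin n) ℂ) (ε : ℝ) : Set ℂ :=
  {z | ∃ E : Matrix (Fin n) (Fin n) ℂ, ‖E‖ ≤ ε ∧ z ∈ spectrum ℂ (A + E)}

/-- `C` is a connected component (a maximal connected subset) of `S`. -/
def IsComponent (C S : Set ℂ) : Prop :=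
  ∃ z ∈ S, C = connectedComponentIn S z

/-- A rectifiable closed Jordan curve, in a Lipschitz parametrization over `[0, 1]`. Every
rectifiable curve has one (proportional to arc length), and the line integral does not depend on
the parametrization. Values of `toFun` outside `[0, 1]` play no role. -/
structure RectifiableJordanCurve where
  toFun : ℝ → ℂ
  lipschitz : ∃ K : NNReal, LipschitzOnWith K toFun (Set.Icc 0 1)
  closed : toFun 0 = toFun 1
  simple : Set.InjOn toFun (Set.Ico 0 1)

namespace RectifiableJordanCurve

/-- The set of points on the curve. -/
def image (γ : RectifiableJordanCurve) : Set ℂ :=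
  γ.toFun '' Set.Icc 0 1

/-- The line integral `∫_γ f(z) dz`. -/
noncomputable def integral {F : Type*} [NormedAddCommGroup F] [NormedSpace ℂ F]
    (γ : RectifiableJordanCurve) (f : ℂ → F) : F :=
  ∫ s in (0 : ℝ)..1, deriv γ.toFun s • f (γ.toFun s)

/-- The index (winding number) of the curve about a point `w` off the curve. -/
noncomputable def index (γ : RectifiableJordanCurve) (w : ℂ) : ℂ :=
  (2 * Real.pi * Complex.I)⁻¹ * γ.integral (fun z => (z - w)⁻¹)

end RectifiableJordanCurve

/-- A Cauchy contour: the oriented boundary of a bounded Cauchy domain `inner`, that is, of a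
bounded open set with finitely many connected components, whose closures are pairwise disjoint,
and whose boundary consists of finitely many pairwise disjoint rectifiable closed Jordan curves.
The orientation is the one for which the domain lies to the left of each of the curves: the
curves together wind once around each point of the domain and do not wind around the points
outside its closure. -/
structure CauchyContour where
  inner : Set ℂ
  numCurves : ℕ
  curve : Fin numCurves → RectifiableJordanCurve
  isOpen_inner : IsOpen inner
  isBounded_inner : Bornology.IsBounded inner
  finite_components : {C : Set ℂ | IsComponent C inner}.Finite
  disjoint_closures : ∀ C C' : Set ℂ, IsComponent C inner → IsComponent C' inner → C ≠ C' →
    Disjoint (closure C) (closure C')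
  frontier_inner : frontier inner = ⋃ k, (curve k).image
  disjoint_curves : ∀ k l, k ≠ l → Disjoint (curve k).image (curve l).image
  index_inner : ∀ w ∈ inner, ∑ k, (curve k).index w = 1
  index_outer : ∀ w ∉ closure inner, ∑ k, (curve k).index w = 0

namespace CauchyContour

/-- `Ext(Γ)`, the complement of the closed region bounded by `Γ`; `Int(Γ)` is `Γ.inner`. -/
def outer (Γ : CauchyContour) : Set ℂ :=
  (closure Γ.inner)ᶜ

/-- The set of points on `Γ`. -/
def image (Γ : CauchyContour) : Set ℂ :=
  ⋃ k, (Γ.curve k).image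

/-- The line integral `∫_Γ f(z) dz`. -/
noncomputable def integral {F : Type*} [NormedAddCommGroup F] [NormedSpace ℂ F]
    (Γ : CauchyContour) (f : ℂ → F) : F :=
  ∑ k, (Γ.curve k).integral f

end CauchyContour

/-- `-1/(2πi) ∫_Γ (A - zI)⁻¹ dz`. -/
noncomputable def spectralProjection {n : ℕ} (Γ : CauchyContour)
    (A : Matrix (Fin n) (Fin n) ℂ) : Matrix (Fin n) (Fin n) ℂ :=
  (-1 / (2 * Real.pi * Complex.I) : ℂ) •
    Γ.integral (fun z => (A - z • (1 : Matrix (Fin n) (Fin n) ℂ))⁻¹)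

open Classical in
/-- The number of eigenvalues of `A` in `S`, counted with algebraic multiplicity. -/
noncomputable def eigenvalueCount {n : ℕ} (A : Matrix (Fin n) (Fin n) ℂ) (S : Set ℂ) : ℕ :=
  A.charpoly.roots.countP (fun z => z ∈ S)

end SpectralPerturbation

/-!
The pseudospectrum is compact, and everything rests on separating two disjoint closed parts `K`
and `L` of it by a Cauchy contour `Γ`, with `K` inside and `L` outside. The spectrum of every
admissible `A + tE` then avoids `Γ`.

*The Riesz projection.* On the generalized eigenspace of a matrix `M` for `μ`, the resolvent is a
finite sum of powers of `(z - μ)⁻¹` with nilpotent coefficients. The first power integrates to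
`2πi` times the winding number of `Γ` about `μ`; the integrals of the higher powers are, up to
constants, derivatives of it with respect to `μ`, and vanish because the winding number is locally
constant. So the projection is the identity on the
generalized eigenspaces inside `Γ` and zero on those outside
(`selectsEigenspaces_spectralProjection`). This gives idempotence, commutation and the two
restricted spectra, and identifies the rank with the number of eigenvalues inside `Γ`, counted with
algebraic multiplicity. Along `t ↦ A + tE` the projection is analytic, so its trace is continuous
with values in the natural numbers, hence constant (`eigenvalueCount_inner_eq`).

*Existence of the contour* (`exists_cauchyContour`). The plane is tiled by small bricks, laid as in
a wall, and `Int(Γ)` is the interior of the union of the bricks that meet `K`. As no more than three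
bricks meet at a vertex, each boundary vertex has exactly one outgoing and one incoming boundary
edge. The passage to the next vertex is therefore a permutation, whose cycles are the required
Jordan polygons (`exists_polygons_of_perm`). Winding numbers are counted cell by
cell, as interior edges cancel.

*Components.* By constancy of the count, every nonempty clopen part of the pseudospectrum contains
an eigenvalue of `A`. So there are finitely many components, each of them clopen
(`isClopen_connectedComponent_pseudospectrum`), and a union of components is separated from the
rest.
-/

namespace SpectralPerturbation

open MeasureTheory Set Filter Topology

/-! ### Line integrals over rectifiable curves -/

namespace RectifiableJordanCurve

variable {F : Type*} [NormedAddCommGroup F] [NormedSpace ℂ F]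

theorem continuousOn (γ : RectifiableJordanCurve) : ContinuousOn γ.toFun (Icc 0 1) :=
  γ.lipschitz.choose_spec.continuousOn

theorem isCompact_image (γ : RectifiableJordanCurve) : IsCompact γ.image :=
  isCompact_Icc.image_of_continuousOn γ.continuousOn

theorem exists_norm_deriv_le (γ : RectifiableJordanCurve) :
    ∃ K : ℝ, 0 ≤ K ∧ ∀ s ∈ Ioo (0 : ℝ) 1, ‖deriv γ.toFun s‖ ≤ K := by
  obtain ⟨K, hK⟩ := γ.lipschitz
  exact ⟨K, K.2, fun s hs => norm_deriv_le_of_lipschitzOn (Icc_mem_nhds hs.1 hs.2) hK⟩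

theorem intervalIntegrable_deriv (γ : RectifiableJordanCurve) :
    IntervalIntegrable (deriv γ.toFun) volume 0 1 := by
  obtain ⟨K, -, hK⟩ := γ.exists_norm_deriv_le
  rw [intervalIntegrable_iff_integrableOn_Ioo_of_le zero_le_one]
  refine Measure.integrableOn_of_bounded (M := K) (by simp)
    (aestronglyMeasurable_deriv _ _) ?_
  filter_upwards [ae_restrict_mem measurableSet_Ioo] with s hs using hK s hs

theorem continuousOn_comp {F : Type*} [TopologicalSpace F] {γ : RectifiableJordanCurve}
    {f : ℂ → F}
    (hf : ContinuousOn f γ.image) : ContinuousOn (fun s => f (γ.toFun s)) (Icc 0 1) :=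
  hf.comp γ.continuousOn fun s hs => ⟨s, hs, rfl⟩

theorem intervalIntegrable {γ : RectifiableJordanCurve} {f : ℂ → F}
    (hf : ContinuousOn f γ.image) :
    IntervalIntegrable (fun s => deriv γ.toFun s • f (γ.toFun s)) volume 0 1 := by
  refine γ.intervalIntegrable_deriv.smul_continuousOn ?_
  rw [uIcc_of_le zero_le_one]
  exact continuousOn_comp hf

/-- A curve integral may be differentiated with respect to a complex parameter under the
integral sign. -/
theorem hasDerivAt_integral (γ : RectifiableJordanCurve) {U : Set ℂ} (hU : IsOpen U)
    {G G' : ℂ → ℂ → F} (hG : ∀ t ∈ U, ContinuousOn (G t) γ.image)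
    (hG' : ContinuousOn (Function.uncurry G') (U ×ˢ γ.image))
    (hd : ∀ t ∈ U, ∀ z ∈ γ.image, HasDerivAt (fun t => G t z) (G' t z) t) {t₀ : ℂ}
    (ht₀ : t₀ ∈ U) :
    HasDerivAt (fun t => γ.integral (G t)) (γ.integral (G' t₀)) t₀ := by
  obtain ⟨K, hK0, hK⟩ := γ.exists_norm_deriv_le
  obtain ⟨r, hr, hrU⟩ := Metric.nhds_basis_closedBall.mem_iff.1 (hU.mem_nhds ht₀)
  obtain ⟨C, hC⟩ :=
    ((isCompact_closedBall t₀ r).prod γ.isCompact_image).exists_bound_of_continuousOn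
    (hG'.mono (prod_mono hrU subset_rfl))
  have hG't : ∀ t ∈ U, ContinuousOn (G' t) γ.image := fun t ht =>
    hG'.comp (continuousOn_const.prodMk continuousOn_id) fun z hz => ⟨ht, hz⟩
  have himg : ∀ s ∈ uIoc (0 : ℝ) 1, γ.toFun s ∈ γ.image := fun s hs => by
    rw [uIoc_of_le zero_le_one] at hs
    exact ⟨s, Ioc_subset_Icc_self hs, rfl⟩
  refine (intervalIntegral.hasDerivAt_integral_of_dominated_loc_of_deriv_le
    (F := fun t s => deriv γ.toFun s • G t (γ.toFun s))
    (F' := fun t s => deriv γ.toFun s • G' t (γ.toFun s)) (bound := fun _ => K * C)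
    (Metric.closedBall_mem_nhds t₀ hr) ?_
    (intervalIntegrable (hG t₀ ht₀)) (intervalIntegrable (hG't t₀ ht₀)).def'.1 ?_
    intervalIntegrable_const ?_).2
  · filter_upwards [hU.mem_nhds ht₀] with t ht
    exact (intervalIntegrable (hG t ht)).def'.1
  · filter_upwards [Measure.ae_ne volume (1 : ℝ)] with s hs1 hs t ht
    have hs' : s ∈ Ioo (0 : ℝ) 1 := by
      rw [uIoc_of_le zero_le_one] at hs
      exact ⟨hs.1, lt_of_le_of_ne hs.2 hs1⟩
    rw [norm_smul]
    exact mul_le_mul (hK s hs') (hC (t, γ.toFun s) ⟨ht, himg s hs⟩) (norm_nonneg _) hK0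
  · refine ae_of_all _ fun s hs t ht => ?_
    exact (hd t (hrU ht) _ (himg s hs)).const_smul (deriv γ.toFun s)

theorem integral_clm_comp [CompleteSpace F] {E : Type*} [NormedAddCommGroup E]
    [NormedSpace ℂ E] [CompleteSpace E] (γ : RectifiableJordanCurve) {f : ℂ → F}
    (hf : ContinuousOn f γ.image)
    (L : F →L[ℂ] E) : γ.integral (fun z => L (f z)) = L (γ.integral f) := by
  simp only [integral]
  rw [← L.intervalIntegral_comp_comm (intervalIntegrable hf)]
  simp

theorem integral_congr {γ : RectifiableJordanCurve} {f g : ℂ → F} (h : EqOn f g γ.image) :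
    γ.integral f = γ.integral g := by
  refine intervalIntegral.integral_congr fun s hs => ?_
  rw [uIcc_of_le zero_le_one] at hs
  simp only [h ⟨s, hs, rfl⟩]

theorem integral_sum {ι : Type*} (γ : RectifiableJordanCurve) (S : Finset ι)
    {f : ι → ℂ → F} (hf : ∀ i ∈ S, ContinuousOn (f i) γ.image) :
    γ.integral (fun z => ∑ i ∈ S, f i z) = ∑ i ∈ S, γ.integral (f i) := by
  unfold integral
  rw [← intervalIntegral.integral_finsetSum fun i hi => intervalIntegrable (hf i hi)]
  simp only [Finset.smul_sum]

end RectifiableJordanCurve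

/-! ### Integrals over Cauchy contours -/

namespace CauchyContour

variable {F : Type*} [NormedAddCommGroup F] [NormedSpace ℂ F]

theorem image_eq_frontier (Γ : CauchyContour) : Γ.image = frontier Γ.inner :=
  Γ.frontier_inner.symm

theorem isOpen_outer (Γ : CauchyContour) : IsOpen Γ.outer :=
  isClosed_closure.isOpen_compl

theorem isCompact_image (Γ : CauchyContour) : IsCompact Γ.image :=
  isCompact_iUnion fun k => (Γ.curve k).isCompact_image

theorem disjoint_inner_outer (Γ : CauchyContour) : Disjoint Γ.inner Γ.outer :=
  disjoint_compl_right_iff_subset.2 subset_closure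

theorem mem_inner_or_mem_outer_iff (Γ : CauchyContour) {w : ℂ} :
    w ∈ Γ.inner ∨ w ∈ Γ.outer ↔ w ∉ Γ.image := by
  rw [Γ.image_eq_frontier, frontier, Γ.isOpen_inner.interior_eq, outer, mem_compl_iff,
    Set.mem_sdiff]
  tauto

theorem curve_image_subset (Γ : CauchyContour) (k : Fin Γ.numCurves) :
    (Γ.curve k).image ⊆ Γ.image :=
  subset_iUnion (fun k => (Γ.curve k).image) k

theorem hasDerivAt_integral (Γ : CauchyContour) {U : Set ℂ} (hU : IsOpen U)
    {G G' : ℂ → ℂ → F} (hG : ∀ t ∈ U, ContinuousOn (G t) Γ.image)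
    (hG' : ContinuousOn (Function.uncurry G') (U ×ˢ Γ.image))
    (hd : ∀ t ∈ U, ∀ z ∈ Γ.image, HasDerivAt (fun t => G t z) (G' t z) t) {t₀ : ℂ}
    (ht₀ : t₀ ∈ U) :
    HasDerivAt (fun t => Γ.integral (G t)) (Γ.integral (G' t₀)) t₀ :=
  HasDerivAt.fun_sum fun k _ => (Γ.curve k).hasDerivAt_integral hU
    (fun t ht => (hG t ht).mono (Γ.curve_image_subset k))
    (hG'.mono (prod_mono subset_rfl (Γ.curve_image_subset k)))
    (fun t ht z hz => hd t ht z (Γ.curve_image_subset k hz)) ht₀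

theorem integral_clm_comp [CompleteSpace F] {E : Type*} [NormedAddCommGroup E]
    [NormedSpace ℂ E] [CompleteSpace E] (Γ : CauchyContour) {f : ℂ → F}
    (hf : ContinuousOn f Γ.image)
    (L : F →L[ℂ] E) : Γ.integral (fun z => L (f z)) = L (Γ.integral f) := by
  simp only [integral, map_sum]
  exact Finset.sum_congr rfl fun k _ =>
    (Γ.curve k).integral_clm_comp (hf.mono (Γ.curve_image_subset k)) L

theorem integral_congr {Γ : CauchyContour} {f g : ℂ → F} (h : EqOn f g Γ.image) :
    Γ.integral f = Γ.integral g :=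
  Finset.sum_congr rfl fun k _ =>
    RectifiableJordanCurve.integral_congr (h.mono (Γ.curve_image_subset k))

theorem integral_sum {ι : Type*} (Γ : CauchyContour) (S : Finset ι)
    {f : ι → ℂ → F} (hf : ∀ i ∈ S, ContinuousOn (f i) Γ.image) :
    Γ.integral (fun z => ∑ i ∈ S, f i z) = ∑ i ∈ S, Γ.integral (f i) := by
  simp only [integral]
  rw [Finset.sum_comm]
  exact Finset.sum_congr rfl fun k _ => (Γ.curve k).integral_sum S
    fun i hi => (hf i hi).mono (Γ.curve_image_subset k)

theorem continuousOn_inv_sub_pow {S : Set ℂ} {w : ℂ} (hw : w ∉ S) (j : ℕ) :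
    ContinuousOn (fun z => ((z - w)⁻¹) ^ j) S := by
  refine ContinuousOn.pow (ContinuousOn.inv₀ (by fun_prop) fun z hz h => hw ?_) j
  rwa [← sub_eq_zero.1 h]

/-- Differentiating the Cauchy kernel with respect to the pole. -/
theorem hasDerivAt_integral_inv_pow (Γ : CauchyContour) (j : ℕ) {w : ℂ} (hw : w ∉ Γ.image) :
    HasDerivAt (fun w => Γ.integral fun z => ((z - w)⁻¹) ^ (j + 1))
      ((j + 1) * Γ.integral fun z => ((z - w)⁻¹) ^ (j + 2)) w := by
  have hne : ∀ t ∈ Γ.imageᶜ, ∀ z ∈ Γ.image, z - t ≠ 0 := fun t ht z hz h => ht (by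
    rwa [← sub_eq_zero.1 h])
  have := Γ.hasDerivAt_integral Γ.isCompact_image.isClosed.isOpen_compl
    (G := fun w z => ((z - w)⁻¹) ^ (j + 1))
    (G' := fun w z => ((j : ℂ) + 1) * ((z - w)⁻¹) ^ (j + 2))
    (fun t ht => continuousOn_inv_sub_pow ht _) ?_ ?_ hw
  · exact this.congr_deriv (Γ.integral_clm_comp (continuousOn_inv_sub_pow hw (j + 2))
      (ContinuousLinearMap.mul ℂ ℂ ((j : ℂ) + 1)))
  · refine ContinuousOn.mul (by fun_prop) (ContinuousOn.pow (ContinuousOn.inv₀ (by fun_prop) ?_) _)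
    rintro ⟨t, z⟩ ⟨ht, hz⟩
    exact hne t ht z hz
  · intro t ht z hz
    have h1 : HasDerivAt (fun t => (z - t)⁻¹) (((z - t)⁻¹) ^ 2) t := by
      refine (((hasDerivAt_id t).const_sub z).inv (hne t ht z hz)).congr_deriv ?_
      simp [inv_pow]
    refine (h1.pow (j + 1)).congr_deriv ?_
    push_cast
    ring

theorem integral_inv_sub_of_mem_inner (Γ : CauchyContour) {w : ℂ} (hw : w ∈ Γ.inner) :
    Γ.integral (fun z => (z - w)⁻¹) = 2 * Real.pi * Complex.I := by
  have := Γ.index_inner w hw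
  simp only [RectifiableJordanCurve.index, ← Finset.mul_sum] at this
  rw [inv_mul_eq_one₀ Complex.two_pi_I_ne_zero] at this
  exact this.symm

theorem integral_inv_sub_of_mem_outer (Γ : CauchyContour) {w : ℂ} (hw : w ∈ Γ.outer) :
    Γ.integral (fun z => (z - w)⁻¹) = 0 := by
  have := Γ.index_outer w hw
  simp only [RectifiableJordanCurve.index, ← Finset.mul_sum] at this
  exact (mul_eq_zero.1 this).resolve_left (inv_ne_zero Complex.two_pi_I_ne_zero)

/-- Higher powers of the Cauchy kernel integrate to zero, being derivatives with respect to the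
pole of the locally constant winding number. -/
theorem integral_inv_pow_eq_zero (Γ : CauchyContour) (j : ℕ) {w : ℂ} (hw : w ∉ Γ.image) :
    Γ.integral (fun z => ((z - w)⁻¹) ^ (j + 2)) = 0 := by
  have key : ∀ᶠ v in 𝓝 w, Γ.integral (fun z => ((z - v)⁻¹) ^ (j + 1)) =
      Γ.integral (fun z => ((z - w)⁻¹) ^ (j + 1)) := by
    induction j generalizing w with
    | zero =>
      simp only [zero_add, pow_one]
      rcases Γ.mem_inner_or_mem_outer_iff.2 hw with h | h
      · filter_upwards [Γ.isOpen_inner.mem_nhds h] with v hv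
        rw [Γ.integral_inv_sub_of_mem_inner hv, Γ.integral_inv_sub_of_mem_inner h]
      · filter_upwards [Γ.isOpen_outer.mem_nhds h] with v hv
        rw [Γ.integral_inv_sub_of_mem_outer hv, Γ.integral_inv_sub_of_mem_outer h]
    | succ j ih =>
      have hzero : ∀ v ∉ Γ.image, Γ.integral (fun z => ((z - v)⁻¹) ^ (j + 2)) = 0 := by
        intro v hv
        have h := (Γ.hasDerivAt_integral_inv_pow j hv).unique
          ((hasDerivAt_const v _).congr_of_eventuallyEq (ih hv))
        exact (mul_eq_zero.1 h).resolve_left (by exact_mod_cast Nat.succ_ne_zero j)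
      filter_upwards [Γ.isCompact_image.isClosed.isOpen_compl.mem_nhds hw] with v hv
      rw [hzero v hv, hzero w hw]
  have h := (Γ.hasDerivAt_integral_inv_pow j hw).unique
    ((hasDerivAt_const w _).congr_of_eventuallyEq key)
  exact (mul_eq_zero.1 h).resolve_left (by exact_mod_cast Nat.succ_ne_zero j)

end CauchyContour

/-! ### Endomorphisms that select generalized eigenspaces -/

section Selector

open Module Module.End

variable {V : Type*} [AddCommGroup V] [Module ℂ V]

open Classical in
/-- `p` is the identity on the generalized eigenspaces of `f` for the eigenvalues in `S`, and zero
on all the others. -/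
def SelectsEigenspaces (p f : End ℂ V) (S : Set ℂ) : Prop :=
  ∀ μ, ∀ v ∈ f.maxGenEigenspace μ, p v = if μ ∈ S then v else 0

variable {p f : End ℂ V} {S : Set ℂ}

/-- The image of an eigenvector under `p` tells whether its eigenvalue lies in `S`. -/
theorem SelectsEigenspaces.apply_eigenvector (hp : SelectsEigenspaces p f S) {μ : ℂ} {v : V}
    (hv : f v = μ • v) : (μ ∈ S → p v = v) ∧ (μ ∉ S → p v = 0) := by
  have : v ∈ f.maxGenEigenspace μ :=
    f.genEigenspace_le_maximal μ 1 (mem_eigenspace_iff.2 hv)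
  rw [hp μ v this]
  exact ⟨fun h => if_pos h, fun h => if_neg h⟩

variable [FiniteDimensional ℂ V]

/-- Endomorphisms that agree on the generalized eigenspaces of `f` are equal, as these span. -/
theorem linearMap_ext_of_maxGenEigenspace (f : End ℂ V) {g h : End ℂ V}
    (H : ∀ μ, ∀ v ∈ f.maxGenEigenspace μ, g v = h v) : g = h := by
  have : ⨆ μ, f.maxGenEigenspace μ ≤ LinearMap.eqLocus g h := iSup_le fun μ v hv => H μ v hv
  rw [iSup_maxGenEigenspace_eq_top] at this
  exact LinearMap.ext fun v => this (Submodule.mem_top (x := v))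

namespace SelectsEigenspaces

theorem isIdempotentElem (hp : SelectsEigenspaces p f S) : IsIdempotentElem p := by
  refine linearMap_ext_of_maxGenEigenspace f fun μ v hv => ?_
  by_cases h : μ ∈ S <;> simp [hp μ v hv, h]

theorem commute (hp : SelectsEigenspaces p f S) : Commute p f := by
  refine linearMap_ext_of_maxGenEigenspace f fun μ v hv => ?_
  have hfv : f v ∈ f.maxGenEigenspace μ := mapsTo_maxGenEigenspace_of_comm (Commute.refl f) μ hv
  by_cases h : μ ∈ S <;> simp [hp μ v hv, hp μ _ hfv, h]

open Classical in
/-- The rank of the selecting projection is the number of eigenvalues in `S`, counted with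
algebraic multiplicity: the trace is the sum of the dimensions of the selected generalized
eigenspaces. -/
theorem finrank_range (hp : SelectsEigenspaces p f S) :
    finrank ℂ (LinearMap.range p) = f.charpoly.roots.countP (· ∈ S) := by
  have hds := DirectSum.isInternal_submodule_of_iSupIndep_of_iSup_eq_top
    f.independent_maxGenEigenspace (iSup_maxGenEigenspace_eq_top f)
  have hfin : {μ | f.maxGenEigenspace μ ≠ ⊥}.Finite :=
    WellFoundedGT.finite_ne_bot_of_iSupIndep f.independent_maxGenEigenspace
  have hmaps : ∀ μ, MapsTo p (f.maxGenEigenspace μ) (f.maxGenEigenspace μ) := fun μ v hv => by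
    rw [hp μ v hv]
    split_ifs
    exacts [hv, Submodule.zero_mem _]
  have htr := LinearMap.trace_eq_sum_trace_restrict' hds hfin hmaps
  rw [(LinearMap.IsIdempotentElem.isProj_range p hp.isIdempotentElem).trace] at htr
  have hterm : ∀ μ, LinearMap.trace ℂ _ (p.restrict (hmaps μ)) =
      (((f.charpoly.roots.filter (· ∈ S)).count μ : ℕ) : ℂ) := by
    intro μ
    rw [Multiset.count_filter]
    split_ifs with h
    · have : p.restrict (hmaps μ) = LinearMap.id := by
        refine LinearMap.ext fun v => Subtype.ext ?_
        exact (hp μ v v.2).trans (if_pos h)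
      rw [this, LinearMap.trace_id, LinearMap.finrank_maxGenEigenspace_eq, Polynomial.count_roots]
    · have : p.restrict (hmaps μ) = 0 := by
        refine LinearMap.ext fun v => Subtype.ext ?_
        exact (hp μ v v.2).trans (if_neg h)
      rw [this, map_zero, Nat.cast_zero]
  simp only [hterm] at htr
  rw [Multiset.countP_eq_card_filter, ← Multiset.sum_count_eq_card (s := hfin.toFinset)]
  · exact_mod_cast htr
  · intro μ hμ
    have h1 : 0 < f.charpoly.rootMultiplicity μ := by
      rw [← Polynomial.count_roots, Multiset.count_pos]
      exact Multiset.mem_of_mem_filter hμ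
    rw [← LinearMap.finrank_maxGenEigenspace_eq] at h1
    simp only [Finite.mem_toFinset, mem_ofPred_eq]
    intro h
    rw [h, finrank_bot] at h1
    exact lt_irrefl _ h1

theorem spectrum_restrict_range (hp : SelectsEigenspaces p f S)
    (hY : ∀ x ∈ LinearMap.range p, f x ∈ LinearMap.range p) :
    spectrum ℂ (f.restrict hY) = spectrum ℂ f ∩ S := by
  ext μ
  rw [mem_inter_iff, ← hasEigenvalue_iff_mem_spectrum, ← hasEigenvalue_iff_mem_spectrum]
  constructor
  · intro h
    obtain ⟨⟨v, hv⟩, h⟩ := h.exists_hasEigenvector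
    have hfv : f v = μ • v := congrArg Subtype.val h.apply_eq_smul
    have hv0 : v ≠ 0 := fun h0 => h.2 (Subtype.ext h0)
    refine ⟨hasEigenvalue_of_hasEigenvector ⟨mem_eigenspace_iff.2 hfv, hv0⟩, ?_⟩
    by_contra hS
    rw [LinearMap.IsIdempotentElem.mem_range_iff hp.isIdempotentElem,
      (hp.apply_eigenvector hfv).2 hS] at hv
    exact hv0 hv.symm
  · rintro ⟨h, hS⟩
    obtain ⟨v, h⟩ := h.exists_hasEigenvector
    refine hasEigenvalue_of_hasEigenvector
      (x := ⟨v, v, (hp.apply_eigenvector h.apply_eq_smul).1 hS⟩)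
      ⟨mem_eigenspace_iff.2 (Subtype.ext h.apply_eq_smul), fun h0 => h.2 (congrArg Subtype.val h0)⟩

theorem spectrum_restrict_ker (hp : SelectsEigenspaces p f S)
    (hZ : ∀ x ∈ LinearMap.ker p, f x ∈ LinearMap.ker p) :
    spectrum ℂ (f.restrict hZ) = spectrum ℂ f \ S := by
  ext μ
  rw [Set.mem_sdiff, ← hasEigenvalue_iff_mem_spectrum, ← hasEigenvalue_iff_mem_spectrum]
  constructor
  · intro h
    obtain ⟨⟨v, hv⟩, h⟩ := h.exists_hasEigenvector
    have hfv : f v = μ • v := congrArg Subtype.val h.apply_eq_smul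
    have hv0 : v ≠ 0 := fun h0 => h.2 (Subtype.ext h0)
    refine ⟨hasEigenvalue_of_hasEigenvector ⟨mem_eigenspace_iff.2 hfv, hv0⟩, fun hS => hv0 ?_⟩
    rw [← (hp.apply_eigenvector hfv).1 hS]
    exact hv
  · rintro ⟨h, hS⟩
    obtain ⟨v, h⟩ := h.exists_hasEigenvector
    refine hasEigenvalue_of_hasEigenvector
      (x := ⟨v, (hp.apply_eigenvector h.apply_eq_smul).2 hS⟩)
      ⟨mem_eigenspace_iff.2 (Subtype.ext h.apply_eq_smul), fun h0 => h.2 (congrArg Subtype.val h0)⟩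

end SelectsEigenspaces

end Selector

/-! ### The Riesz projection of a matrix -/

section Riesz

open Module.End

variable {n : ℕ} {A E M : Matrix (Fin n) (Fin n) ℂ}

theorem notMem_spectrum_iff {z : ℂ} :
    z ∉ spectrum ℂ M ↔ IsUnit (M - z • (1 : Matrix (Fin n) (Fin n) ℂ)) := by
  rw [spectrum.notMem_iff, Algebra.algebraMap_eq_smul_one, ← neg_sub, IsUnit.neg_iff]

theorem spectrum_toLin' (M : Matrix (Fin n) (Fin n) ℂ) :
    spectrum ℂ (Matrix.toLin' M) = spectrum ℂ M :=
  AlgEquiv.spectrum_eq Matrix.toLinAlgEquiv' M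

/-- The shifted inverse is jointly continuous wherever it exists. -/
theorem continuousOn_resolvent {X : Type*} [TopologicalSpace X] {s : Set X}
    {f : X → Matrix (Fin n) (Fin n) ℂ} {g : X → ℂ} (hf : ContinuousOn f s) (hg : ContinuousOn g s)
    (h : ∀ x ∈ s, g x ∉ spectrum ℂ (f x)) :
    ContinuousOn (fun x => (f x - g x • (1 : Matrix (Fin n) (Fin n) ℂ))⁻¹) s := by
  intro x hx
  obtain ⟨u, hu⟩ := notMem_spectrum_iff.1 (h x hx)
  have h1 := NormedRing.inverse_continuousAt u
  rw [hu] at h1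
  simp only [Matrix.nonsing_inv_eq_ringInverse]
  exact ContinuousAt.comp_continuousWithinAt (f := fun x => f x - g x • 1) h1
    ((hf x hx).sub ((hg x hx).smul continuousWithinAt_const))

theorem hasDerivAt_resolvent {t z : ℂ} (h : z ∉ spectrum ℂ (A + t • E)) :
    HasDerivAt (fun t : ℂ => (A + t • E - z • (1 : Matrix (Fin n) (Fin n) ℂ))⁻¹)
      (-((A + t • E - z • 1)⁻¹ * E * (A + t • E - z • 1)⁻¹)) t := by
  obtain ⟨u, hu⟩ := notMem_spectrum_iff.1 h
  have h1 : HasDerivAt (fun t : ℂ => A + t • E - z • (1 : Matrix (Fin n) (Fin n) ℂ)) E t := by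
    simpa using (((hasDerivAt_id t).smul_const E).const_add A).sub_const
      (z • (1 : Matrix (Fin n) (Fin n) ℂ))
  have h2 := hasFDerivAt_ringInverse (𝕜 := ℂ) u
  rw [hu] at h2
  simp only [Matrix.nonsing_inv_eq_ringInverse]
  refine (h2.comp_hasDerivAt t h1).congr_deriv ?_
  rw [← hu, Ring.inverse_unit]
  simp

/-- On a generalized eigenvector the resolvent is a finite sum of poles at the eigenvalue. -/
theorem resolvent_mulVec {z μ : ℂ} (hz : z ∉ spectrum ℂ M) (hne : z - μ ≠ 0) {k : ℕ}
    {v : Fin n → ℂ} (hv : ((Matrix.toLin' M - μ • 1) ^ k) v = 0) :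
    (M - z • (1 : Matrix (Fin n) (Fin n) ℂ))⁻¹.mulVec v =
      -∑ j ∈ Finset.range k, ((z - μ)⁻¹) ^ (j + 1) • ((Matrix.toLin' M - μ • 1) ^ j) v := by
  set N : Module.End ℂ (Fin n → ℂ) := Matrix.toLin' M - μ • 1
  have hM : ∀ w, (M - z • (1 : Matrix (Fin n) (Fin n) ℂ)).mulVec w = N w - (z - μ) • w := by
    intro w
    simp only [N, Matrix.sub_mulVec, Matrix.smul_mulVec, Matrix.one_mulVec, LinearMap.sub_apply,
      Matrix.toLin'_apply, LinearMap.smul_apply, Module.End.one_apply, sub_smul]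
    abel
  -- the geometric sum telescopes under `M - z`
  have key : ∀ m, (M - z • (1 : Matrix (Fin n) (Fin n) ℂ)).mulVec
      (-∑ j ∈ Finset.range m, ((z - μ)⁻¹) ^ (j + 1) • (N ^ j) v) =
        v - ((z - μ)⁻¹) ^ m • (N ^ m) v := by
    intro m
    induction m with
    | zero => simp
    | succ m ih =>
      rw [Finset.sum_range_succ, neg_add, Matrix.mulVec_add, ih, hM, map_neg, map_smul,
        ← Module.End.mul_apply, ← pow_succ', smul_neg, smul_smul, pow_succ (z - μ)⁻¹ m,
        mul_comm (z - μ), mul_assoc, inv_mul_cancel₀ hne, mul_one]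
      abel
  have h := key k
  rw [hv, smul_zero, sub_zero] at h
  have hdet := (Matrix.isUnit_iff_isUnit_det _).1 (notMem_spectrum_iff.1 hz)
  rw [← h, Matrix.mulVec_mulVec, Matrix.nonsing_inv_mul _ hdet, Matrix.one_mulVec, h]

/-- On the generalized eigenspace for `μ` the integral of the resolvent is multiplication by
`-2πi` times the winding number about `μ`. -/
theorem integral_resolvent_mulVec (Γ : CauchyContour) (hM : ∀ z ∈ Γ.image, z ∉ spectrum ℂ M)
    {μ : ℂ} (hμ : μ ∉ Γ.image) {v : Fin n → ℂ}
    (hv : v ∈ maxGenEigenspace (Matrix.toLin' M) μ) :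
    (Γ.integral fun z => (M - z • (1 : Matrix (Fin n) (Fin n) ℂ))⁻¹).mulVec v =
      -(Γ.integral fun z => (z - μ)⁻¹) • v := by
  obtain ⟨k, hk⟩ := (mem_maxGenEigenspace _ _ _).1 hv
  -- one term at least, so that the sum below contains the simple pole
  have hk' : ((Matrix.toLin' M - μ • 1) ^ (k + 1)) v = 0 := by
    rw [pow_succ', Module.End.mul_apply, hk, map_zero]
  let L : Matrix (Fin n) (Fin n) ℂ →L[ℂ] (Fin n → ℂ) :=
    LinearMap.toContinuousLinearMap
      { toFun := fun B => B.mulVec v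
        map_add' := fun B C => Matrix.add_mulVec B C v
        map_smul' := fun c B => Matrix.smul_mulVec c B v }
  have h1 := Γ.integral_clm_comp
    (continuousOn_resolvent (f := fun _ => M) continuousOn_const continuousOn_id hM) L
  have h2 : ∀ j, Γ.integral (fun z => ((z - μ)⁻¹) ^ (j + 1) •
      ((Matrix.toLin' M - μ • 1) ^ j) v) =
        (Γ.integral fun z => ((z - μ)⁻¹) ^ (j + 1)) • ((Matrix.toLin' M - μ • 1) ^ j) v := fun j =>
    Γ.integral_clm_comp (CauchyContour.continuousOn_inv_sub_pow hμ (j + 1))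
      ((ContinuousLinearMap.id ℂ ℂ).smulRight (((Matrix.toLin' M - μ • 1) ^ j) v))
  have hcont : ∀ j, ContinuousOn (fun z => ((z - μ)⁻¹) ^ (j + 1) •
      ((Matrix.toLin' M - μ • 1) ^ j) v) Γ.image := fun j =>
    (CauchyContour.continuousOn_inv_sub_pow hμ (j + 1)).smul continuousOn_const
  change L _ = _
  simp only [id] at h1
  rw [← h1, CauchyContour.integral_congr (g := fun z => (-ContinuousLinearMap.id ℂ (Fin n → ℂ))
      (∑ j ∈ Finset.range (k + 1), ((z - μ)⁻¹) ^ (j + 1) • ((Matrix.toLin' M - μ • 1) ^ j) v)),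
    Γ.integral_clm_comp (continuousOn_finsetSum _ fun j _ => hcont j),
    Γ.integral_sum _ (fun j _ => hcont j), Finset.sum_range_succ', Finset.sum_eq_zero]
  · rw [h2 0]
    simp
  · intro j _
    rw [h2 (j + 1), Γ.integral_inv_pow_eq_zero j hμ, zero_smul]
  · intro z hz
    have hne : z - μ ≠ 0 := fun h => hμ (sub_eq_zero.1 h ▸ hz)
    exact resolvent_mulVec (hM z hz) hne hk'

theorem selectsEigenspaces_spectralProjection (Γ : CauchyContour)
    (hM : ∀ z ∈ Γ.image, z ∉ spectrum ℂ M) :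
    SelectsEigenspaces (Matrix.toLin' (spectralProjection Γ M)) (Matrix.toLin' M) Γ.inner := by
  intro μ v hv
  by_cases hμ : μ ∈ Γ.image
  · -- no generalized eigenvectors belong to a point of the contour
    have h := hM μ hμ
    rw [← spectrum_toLin', ← hasEigenvalue_iff_mem_spectrum] at h
    have hbot : maxGenEigenspace (Matrix.toLin' M) μ = ⊥ := by
      by_contra hne
      obtain ⟨k, hk⟩ : ∃ k : ℕ, genEigenspace (Matrix.toLin' M) μ k ≠ ⊥ := by
        by_contra! hall
        refine hne ((Submodule.eq_bot_iff _).2 fun x hx => ?_)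
        obtain ⟨k, hk⟩ := (mem_maxGenEigenspace _ _ _).1 hx
        have : x ∈ genEigenspace (Matrix.toLin' M) μ k := mem_genEigenspace_nat.2 hk
        rwa [hall k, Submodule.mem_bot] at this
      exact h (hasEigenvalue_of_hasGenEigenvalue (k := k) hk)
    rw [hbot, Submodule.mem_bot] at hv
    simp [hv]
  · rw [Matrix.toLin'_apply, spectralProjection, Matrix.smul_mulVec,
      integral_resolvent_mulVec Γ hM hμ hv]
    split_ifs with h
    · rw [Γ.integral_inv_sub_of_mem_inner h, smul_smul]
      have := Complex.two_pi_I_ne_zero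
      rw [div_mul_eq_mul_div, neg_mul_neg, one_mul, div_self this, one_smul]
    · rw [Γ.integral_inv_sub_of_mem_outer
        ((Γ.mem_inner_or_mem_outer_iff.2 hμ).resolve_left h)]
      simp

theorem rank_spectralProjection (Γ : CauchyContour) (hM : ∀ z ∈ Γ.image, z ∉ spectrum ℂ M) :
    (spectralProjection Γ M).rank = eigenvalueCount M Γ.inner := by
  rw [Matrix.rank_eq_finrank_range_toLin _ (Pi.basisFun ℂ _) (Pi.basisFun ℂ _),
    Matrix.toLin_eq_toLin', (selectsEigenspaces_spectralProjection Γ hM).finrank_range,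
    Matrix.charpoly_toLin']
  rfl

theorem trace_spectralProjection (Γ : CauchyContour) (hM : ∀ z ∈ Γ.image, z ∉ spectrum ℂ M) :
    (spectralProjection Γ M).trace = eigenvalueCount M Γ.inner := by
  have h := (LinearMap.IsIdempotentElem.isProj_range _
    (selectsEigenspaces_spectralProjection Γ hM).isIdempotentElem).trace
  rw [(selectsEigenspaces_spectralProjection Γ hM).finrank_range, Matrix.charpoly_toLin',
    Matrix.trace_toLin'_eq] at h
  exact h

theorem differentiableOn_spectralProjection (Γ : CauchyContour) {U : Set ℂ} (hU : IsOpen U)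
    (hres : ∀ t ∈ U, ∀ z ∈ Γ.image, z ∉ spectrum ℂ (A + t • E)) :
    DifferentiableOn ℂ (fun t : ℂ => spectralProjection Γ (A + t • E)) U := by
  have hc : ContinuousOn (fun q : ℂ × ℂ =>
      (A + q.1 • E - q.2 • (1 : Matrix (Fin n) (Fin n) ℂ))⁻¹) (U ×ˢ Γ.image) := by
    refine continuousOn_resolvent (f := fun q : ℂ × ℂ => A + q.1 • E) (g := fun q => q.2) ?_ ?_ ?_
    · exact (continuous_const.add (continuous_fst.smul continuous_const)).continuousOn
    · exact continuous_snd.continuousOn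
    · exact fun q hq => hres q.1 hq.1 q.2 hq.2
  have hc' : ContinuousOn (Function.uncurry fun t z : ℂ =>
      -((A + t • E - z • (1 : Matrix (Fin n) (Fin n) ℂ))⁻¹ * E * (A + t • E - z • 1)⁻¹))
      (U ×ˢ Γ.image) := ((hc.mul continuousOn_const).mul hc).neg
  have hG : ∀ t ∈ U, ContinuousOn
      (fun z => (A + t • E - z • (1 : Matrix (Fin n) (Fin n) ℂ))⁻¹) Γ.image := fun t ht =>
    continuousOn_resolvent continuousOn_const continuousOn_id (hres t ht)
  intro t ht
  have hI := (Γ.hasDerivAt_integral hU hG hc'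
    (fun t ht z hz => hasDerivAt_resolvent (hres t ht z hz)) ht).differentiableAt
  exact (hI.const_smul (-1 / (2 * Real.pi * Complex.I) : ℂ)).differentiableWithinAt

theorem analyticAt_spectralProjection (Γ : CauchyContour) {t₀ : ℂ}
    (h : ∀ z ∈ Γ.image, z ∉ spectrum ℂ (A + t₀ • E)) :
    AnalyticAt ℂ (fun t : ℂ => spectralProjection Γ (A + t • E)) t₀ := by
  -- the contour stays in the resolvent set for `t` near `t₀`, by compactness
  have hopen : IsOpen {q : ℂ × ℂ | q.2 ∉ spectrum ℂ (A + q.1 • E)} := by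
    simp only [notMem_spectrum_iff]
    exact Units.isOpen.preimage (((continuous_const.add (continuous_fst.smul continuous_const)).sub
      (continuous_snd.smul continuous_const)) :
      Continuous fun q : ℂ × ℂ => A + q.1 • E - q.2 • (1 : Matrix (Fin n) (Fin n) ℂ))
  obtain ⟨U, W, hU, -, ht₀, hW, hUW⟩ := generalized_tube_lemma isCompact_singleton
    Γ.isCompact_image hopen (s := {t₀}) (by
      rintro ⟨t, z⟩ ⟨ht, hz⟩
      obtain rfl : t = t₀ := ht
      exact h z hz)
  have hres : ∀ t ∈ U, ∀ z ∈ Γ.image, z ∉ spectrum ℂ (A + t • E) := fun t ht z hz =>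
    mem_ofPred_eq ▸ hUW (mk_mem_prod ht (hW hz))
  exact (differentiableOn_spectralProjection Γ hU hres).analyticAt
    (hU.mem_nhds (ht₀ (mem_singleton t₀)))

/-- Along a connected family `A + tE` of matrices, none of which has an eigenvalue on the contour,
the number of eigenvalues inside the contour is constant: it is the trace of the Riesz projection,
which is continuous and takes values in the natural numbers. -/
theorem eigenvalueCount_inner_eq (Γ : CauchyContour) {S : Set ℂ} (hS : IsPreconnected S)
    (h : ∀ t ∈ S, ∀ z ∈ Γ.image, z ∉ spectrum ℂ (A + t • E)) {t t' : ℂ} (ht : t ∈ S)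
    (ht' : t' ∈ S) :
    eigenvalueCount (A + t • E) Γ.inner = eigenvalueCount (A + t' • E) Γ.inner := by
  have hc : ContinuousOn (fun t : ℂ => (eigenvalueCount (A + t • E) Γ.inner : ℂ)) S := by
    have : ContinuousOn (fun t : ℂ => (spectralProjection Γ (A + t • E)).trace) S := fun t ht =>
      (Continuous.matrix_trace continuous_id).continuousAt.comp_continuousWithinAt
        (analyticAt_spectralProjection Γ (h t ht)).continuousAt.continuousWithinAt
    exact this.congr fun t ht => (trace_spectralProjection Γ (h t ht)).symm
  have hc' : ContinuousOn (fun t : ℂ => (eigenvalueCount (A + t • E) Γ.inner : ℝ)) S :=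
    Complex.continuous_re.comp_continuousOn hc
  exact hS.constant (f := fun t : ℂ => eigenvalueCount (A + t • E) Γ.inner)
    (Nat.isClosedEmbedding_coe_real.isInducing.continuousOn_iff.2 hc') ht ht'

end Riesz

/-! ### Closed polygons -/

/-- The polygonal path through the points `b 0, b 1, …`, at unit speed in the index. -/
noncomputable def polygonalPath (b : ℕ → ℂ) (x : ℝ) : ℂ :=
  b ⌊x⌋₊ + ((x - ⌊x⌋₊ : ℝ) : ℂ) * (b (⌊x⌋₊ + 1) - b ⌊x⌋₊)

/-- The integral of `f` along the line segment from `p` to `q`. -/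
noncomputable def segmentIntegral (p q : ℂ) (f : ℂ → ℂ) : ℂ :=
  (q - p) * ∫ u in (0 : ℝ)..1, f (p + u * (q - p))

theorem polygonalPath_of_mem_Icc (b : ℕ → ℂ) {i : ℕ} {x : ℝ} (hx : x ∈ Icc (i : ℝ) (i + 1)) :
    polygonalPath b x = b i + ((x - i : ℝ) : ℂ) * (b (i + 1) - b i) := by
  rcases hx.2.lt_or_eq with h | h
  · have : ⌊x⌋₊ = i := (Nat.floor_eq_iff (i.cast_nonneg.trans hx.1)).2 ⟨hx.1, h⟩
    rw [polygonalPath, this]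
  · have : ⌊x⌋₊ = i + 1 := by rw [h]; exact_mod_cast Nat.floor_natCast (i + 1)
    rw [polygonalPath, this, h]
    push_cast
    ring

theorem norm_polygonalPath_sub_le {b : ℕ → ℂ} {K : ℝ} (hK : ∀ i, ‖b (i + 1) - b i‖ ≤ K)
    {x y : ℝ} (hx : 0 ≤ x) (hxy : x ≤ y) :
    ‖polygonalPath b y - polygonalPath b x‖ ≤ K * (y - x) := by
  -- induction on an upper bound of `y`, splitting the path at the last vertex
  obtain ⟨m, hm⟩ := exists_nat_ge y
  induction m generalizing y with
  | zero =>
    have hy0 : y = 0 := le_antisymm (by simpa using hm) (hx.trans hxy)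
    have hx0 : x = 0 := le_antisymm (hxy.trans hy0.le) hx
    simp [hy0, hx0]
  | succ m ih =>
    have key : ∀ z : ℝ, (m : ℝ) ≤ z → z ≤ y →
        ‖polygonalPath b y - polygonalPath b z‖ ≤ K * (y - z) := by
      intro z hmz hzy
      push_cast at hm
      rw [polygonalPath_of_mem_Icc b ⟨hmz, hzy.trans hm⟩,
        polygonalPath_of_mem_Icc b ⟨hmz.trans hzy, hm⟩, add_sub_add_left_eq_sub, ← sub_mul,
        ← Complex.ofReal_sub, norm_mul, Complex.norm_real, Real.norm_of_nonneg (by linarith),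
        mul_comm]
      calc _ ≤ K * (y - m - (z - m)) := mul_le_mul_of_nonneg_right (hK m) (by linarith)
        _ = _ := by ring
    rcases le_total y m with h | h
    · exact ih hxy h
    rcases le_total (m : ℝ) x with h' | h'
    · exact key x h' hxy
    · calc ‖polygonalPath b y - polygonalPath b x‖
          ≤ ‖polygonalPath b y - polygonalPath b m‖ + ‖polygonalPath b m - polygonalPath b x‖ := by
            rw [← sub_add_sub_cancel]
            exact norm_add_le _ _
        _ ≤ K * (y - m) + K * (m - x) := add_le_add (key m le_rfl h) (ih h' le_rfl)
        _ = _ := by ring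

theorem hasDerivAt_polygonalPath (b : ℕ → ℂ) {i : ℕ} {x : ℝ} (hx : x ∈ Ioo (i : ℝ) (i + 1)) :
    HasDerivAt (polygonalPath b) (b (i + 1) - b i) x := by
  have h : HasDerivAt (fun x : ℝ => b i + ((x - i : ℝ) : ℂ) * (b (i + 1) - b i))
      (b (i + 1) - b i) x := by
    simpa using ((((hasDerivAt_id x).sub_const (i : ℝ)).ofReal_comp).mul_const
      (b (i + 1) - b i)).const_add (b i)
  refine h.congr_of_eventuallyEq ?_
  filter_upwards [Icc_mem_nhds hx.1 hx.2] with y hy using polygonalPath_of_mem_Icc b hy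

/-- The closed polygon with vertices `b 0, …, b (k - 1)`, for a sequence `b` with `b k = b 0` whose
half-open edges `[b i, b (i + 1))`, `i < k`, do not meet. -/
noncomputable def closedPolygon (b : ℕ → ℂ) (k : ℕ) (hk : 0 < k) (hb : b k = b 0)
    (hlip : ∃ K : ℝ, ∀ i, ‖b (i + 1) - b i‖ ≤ K)
    (hinj : ∀ i < k, ∀ j < k, ∀ u ∈ Ico (0 : ℝ) 1, ∀ v ∈ Ico (0 : ℝ) 1,
      b i + u * (b (i + 1) - b i) = b j + v * (b (j + 1) - b j) → i = j ∧ u = v) :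
    RectifiableJordanCurve where
  toFun s := polygonalPath b (k * s)
  lipschitz := by
    obtain ⟨K, hK⟩ := hlip
    have hK0 : 0 ≤ K := (norm_nonneg _).trans (hK 0)
    refine ⟨⟨K * k, by positivity⟩, LipschitzOnWith.of_dist_le_mul ?_⟩
    have key : ∀ x ∈ Icc (0 : ℝ) 1, ∀ y ∈ Icc (0 : ℝ) 1, x ≤ y →
        dist (polygonalPath b (k * x)) (polygonalPath b (k * y)) ≤ K * k * dist x y := by
      intro x hx y hy hxy
      rw [dist_comm, dist_eq_norm, dist_comm, Real.dist_eq, abs_of_nonneg (by linarith), mul_assoc,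
        mul_sub]
      exact norm_polygonalPath_sub_le hK (mul_nonneg k.cast_nonneg hx.1)
        (mul_le_mul_of_nonneg_left hxy k.cast_nonneg)
    intro x hx y hy
    rcases le_total x y with h | h
    · exact key x hx y hy h
    · rw [dist_comm, dist_comm x y]
      exact key y hy x hx h
  closed := by
    have h0 : polygonalPath b 0 = b 0 := by
      simpa using polygonalPath_of_mem_Icc b (i := 0) (x := 0) (by simp)
    have h1 : polygonalPath b k = b k := by
      simpa using polygonalPath_of_mem_Icc b (i := k) (x := k) (by simp)
    simp [h0, h1, hb]
  simple := by
    have hk' : (0 : ℝ) < k := Nat.cast_pos.2 hk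
    intro s hs t ht hst
    have hfl : ∀ s ∈ Ico (0 : ℝ) 1, ⌊(k : ℝ) * s⌋₊ < k ∧
        (k * s - ⌊(k : ℝ) * s⌋₊ : ℝ) ∈ Ico (0 : ℝ) 1 := by
      intro s hs
      have h0 : 0 ≤ (k : ℝ) * s := mul_nonneg hk'.le hs.1
      refine ⟨(Nat.floor_lt h0).2 ?_, sub_nonneg.2 (Nat.floor_le h0), ?_⟩
      · nlinarith [hs.2]
      · linarith [Nat.lt_floor_add_one ((k : ℝ) * s)]
    obtain ⟨h1, h2⟩ := hinj _ (hfl s hs).1 _ (hfl t ht).1 _ (hfl s hs).2 _ (hfl t ht).2 hst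
    rw [h1] at h2
    exact mul_left_cancel₀ hk'.ne' (by linarith)

section closedPolygon

variable {b : ℕ → ℂ} {k : ℕ} (hk : 0 < k) (hb : b k = b 0)
    (hlip : ∃ K : ℝ, ∀ i, ‖b (i + 1) - b i‖ ≤ K)
    (hinj : ∀ i < k, ∀ j < k, ∀ u ∈ Ico (0 : ℝ) 1, ∀ v ∈ Ico (0 : ℝ) 1,
      b i + u * (b (i + 1) - b i) = b j + v * (b (j + 1) - b j) → i = j ∧ u = v)

theorem image_closedPolygon : (closedPolygon b k hk hb hlip hinj).image =
    {p | ∃ i < k, ∃ u ∈ Ico (0 : ℝ) 1, p = b i + u * (b (i + 1) - b i)} := by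
  have hk' : (0 : ℝ) < k := Nat.cast_pos.2 hk
  ext p
  constructor
  · rintro ⟨s, hs, rfl⟩
    -- the endpoint of the parameter interval gives the initial vertex
    obtain ⟨s', hs', hss'⟩ : ∃ s' ∈ Ico (0 : ℝ) 1, (closedPolygon b k hk hb hlip hinj).toFun s =
        (closedPolygon b k hk hb hlip hinj).toFun s' := by
      rcases hs.2.lt_or_eq with h | rfl
      · exact ⟨s, ⟨hs.1, h⟩, rfl⟩
      · exact ⟨0, by simp, (closedPolygon b k hk hb hlip hinj).closed.symm⟩
    have h0 : 0 ≤ (k : ℝ) * s' := mul_nonneg hk'.le hs'.1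
    refine ⟨⌊(k : ℝ) * s'⌋₊, (Nat.floor_lt h0).2 (by nlinarith [hs'.2]),
      k * s' - ⌊(k : ℝ) * s'⌋₊, ⟨sub_nonneg.2 (Nat.floor_le h0), ?_⟩, hss'⟩
    linarith [Nat.lt_floor_add_one ((k : ℝ) * s')]
  · rintro ⟨i, hi, u, hu, rfl⟩
    have hi' : (i : ℝ) + 1 ≤ k := by exact_mod_cast hi
    refine ⟨(i + u) / k, ⟨div_nonneg (add_nonneg i.cast_nonneg hu.1) hk'.le,
      (div_le_one hk').2 (by linarith [hu.2])⟩, ?_⟩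
    change polygonalPath b (k * ((i + u) / k)) = _
    rw [mul_div_cancel₀ _ hk'.ne', polygonalPath_of_mem_Icc b (i := i)
      ⟨by linarith [hu.1], by linarith [hu.2]⟩]
    simp

theorem integral_closedPolygon {f : ℂ → ℂ}
    (hf : ContinuousOn f (closedPolygon b k hk hb hlip hinj).image) :
    (closedPolygon b k hk hb hlip hinj).integral f =
      ∑ i ∈ Finset.range k, segmentIntegral (b i) (b (i + 1)) f := by
  have hk' : (0 : ℝ) < k := Nat.cast_pos.2 hk
  set γ := closedPolygon b k hk hb hlip hinj
  have hint := RectifiableJordanCurve.intervalIntegrable hf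
  have hadj := intervalIntegral.sum_integral_adjacent_intervals (μ := volume)
    (f := fun s => deriv γ.toFun s • f (γ.toFun s)) (a := fun i : ℕ => (i : ℝ) / k) (n := k) (by
      intro i hi
      have hi' : (i : ℝ) + 1 ≤ k := by exact_mod_cast hi
      refine hint.mono_set ?_
      rw [uIcc_of_le zero_le_one, uIcc_of_le (by push_cast; gcongr; linarith)]
      push_cast
      exact Icc_subset_Icc (by positivity) ((div_le_one hk').2 hi'))
  rw [Nat.cast_zero, zero_div, div_self hk'.ne'] at hadj
  rw [RectifiableJordanCurve.integral, ← hadj]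
  refine Finset.sum_congr rfl fun i hi => ?_
  have hsub := intervalIntegral.integral_comp_div_add (a := 0) (b := 1)
    (fun s => deriv γ.toFun s • f (γ.toFun s)) hk'.ne' ((i : ℝ) / k)
  rw [zero_div, zero_add, ← add_div, add_comm (1 : ℝ)] at hsub
  rw [Nat.cast_succ, segmentIntegral, ← smul_right_inj hk'.ne', ← hsub,
    ← intervalIntegral.integral_const_mul, ← intervalIntegral.integral_smul]
  refine intervalIntegral.integral_congr_ae ?_
  filter_upwards [Measure.ae_ne volume (1 : ℝ)] with u hu1 hu
  rw [uIoc_of_le zero_le_one] at hu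
  have hu' : u < 1 := lt_of_le_of_ne hu.2 hu1
  have hx : (k : ℝ) * (u / k + i / k) = i + u := by
    field_simp
    ring
  have hd : HasDerivAt γ.toFun ((k : ℂ) * (b (i + 1) - b i)) (u / k + i / k) := by
    have h1 := hasDerivAt_polygonalPath b (i := i) (x := k * (u / k + i / k))
      (by rw [hx]; constructor <;> linarith [hu.1])
    have h2 := h1.scomp (u / k + i / k) ((hasDerivAt_id (u / k + i / k)).const_mul (k : ℝ))
    exact (h2 : HasDerivAt γ.toFun _ _).congr_deriv (by simp)
  have hv : γ.toFun (u / k + i / k) = b i + u * (b (i + 1) - b i) := by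
    change polygonalPath b (k * (u / k + i / k)) = _
    rw [hx, polygonalPath_of_mem_Icc b (i := i) ⟨by linarith [hu.1], by linarith⟩]
    simp
  rw [hd.deriv, hv]
  simp
  ring

end closedPolygon

/-- The orbits of a permutation `σ` of finitely many points of the plane, joined by line segments
from each point to its image, form finitely many disjoint closed polygons, if the half-open
segments do not meet. -/
theorem exists_polygons_of_perm {V : Type*} [Fintype V] (σ : Equiv.Perm V) (a : V → ℂ)
    (hinj : ∀ v w, ∀ u ∈ Ico (0 : ℝ) 1, ∀ u' ∈ Ico (0 : ℝ) 1,
      a v + u * (a (σ v) - a v) = a w + u' * (a (σ w) - a w) → v = w ∧ u = u') :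
    ∃ (N : ℕ) (curve : Fin N → RectifiableJordanCurve),
      (⋃ k, (curve k).image) = {p | ∃ v, ∃ u ∈ Ico (0 : ℝ) 1, p = a v + u * (a (σ v) - a v)} ∧
      (∀ k l, k ≠ l → Disjoint (curve k).image (curve l).image) ∧
      ∀ f : ℂ → ℂ, ContinuousOn f (⋃ k, (curve k).image) →
        ∑ k, (curve k).integral f = ∑ v, segmentIntegral (a v) (a (σ v)) f := by
  classical
  let Q := Quotient (Equiv.Perm.SameCycle.setoid σ)
  let k : Q → ℕ := fun c => Function.minimalPeriod σ c.out
  have hper : ∀ v : V, v ∈ Function.periodicPts σ := fun v =>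
    Function.Injective.mem_periodicPts σ.injective v
  have hk : ∀ c, 0 < k c := fun c => Function.minimalPeriod_pos_of_mem_periodicPts (hper _)
  -- every vertex is reached once from the chosen representative of its orbit
  let Φ : (Σ c : Q, Fin (k c)) → V := fun x => σ^[x.2] x.1.out
  have hΦmk : ∀ x, (⟦Φ x⟧ : Q) = x.1 := by
    rintro ⟨c, i⟩
    refine (Quotient.sound (Equiv.Perm.SameCycle.symm ⟨(i : ℕ), ?_⟩)).trans c.out_eq
    simp [Φ, Equiv.Perm.iterate_eq_pow]
  have hΦ : Function.Bijective Φ := by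
    constructor
    · rintro ⟨c, i⟩ ⟨c', j⟩ h
      obtain rfl : c = c' :=
        (hΦmk ⟨c, i⟩).symm.trans ((congrArg (Quotient.mk _) h).trans (hΦmk ⟨c', j⟩))
      have := Function.iterate_injOn_Iio_minimalPeriod (f := σ) (x := c.out) i.2 j.2 h
      rw [Fin.ext this]
    · intro v
      obtain ⟨i, hi⟩ := (Quotient.exact (⟦v⟧ : Q).out_eq : σ.SameCycle _ v).exists_nat_pow_eq
      refine ⟨⟨⟦v⟧, i % k ⟦v⟧, Nat.mod_lt _ (hk _)⟩, ?_⟩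
      change σ^[i % k ⟦v⟧] _ = v
      rw [Function.iterate_mod_minimalPeriod_eq, Equiv.Perm.iterate_eq_pow]
      exact hi
  let b : Q → ℕ → ℂ := fun c i => a (σ^[i] c.out)
  have hb : ∀ c i, b c (i + 1) = a (σ (σ^[i] c.out)) := fun c i => by
    simp only [b, Function.iterate_succ_apply']
  let γ : Q → RectifiableJordanCurve := fun c => closedPolygon (b c) (k c) (hk c)
    (by simp only [b, k, Function.iterate_minimalPeriod, Function.iterate_zero, id])
    (by
      obtain ⟨K, hK⟩ := (finite_range fun v => ‖a (σ v) - a v‖).bddAbove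
      exact ⟨K, fun i => by rw [hb]; exact hK ⟨_, rfl⟩⟩)
    (by
      intro i hi j hj u hu v hv h
      rw [hb, hb] at h
      obtain ⟨h1, h2⟩ := hinj _ _ u hu v hv h
      exact ⟨Function.iterate_injOn_Iio_minimalPeriod (f := σ) (x := c.out) hi hj h1, h2⟩)
  have himg : ∀ c, (γ c).image = {p | ∃ i : Fin (k c), ∃ u ∈ Ico (0 : ℝ) 1,
      p = a (Φ ⟨c, i⟩) + u * (a (σ (Φ ⟨c, i⟩)) - a (Φ ⟨c, i⟩))} := by
    intro c
    refine (image_closedPolygon _ _ _ _).trans ?_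
    ext p
    constructor
    · rintro ⟨i, hi, u, hu, rfl⟩
      exact ⟨⟨i, hi⟩, u, hu, by rw [hb]⟩
    · rintro ⟨i, u, hu, rfl⟩
      exact ⟨i, i.2, u, hu, by rw [hb]⟩
  let e : Fin (Fintype.card Q) ≃ Q := (Fintype.equivFin Q).symm
  refine ⟨Fintype.card Q, fun i => γ (e i), ?_, ?_, ?_⟩
  · rw [e.surjective.iUnion_comp fun c => (γ c).image]
    ext p
    simp only [himg, mem_iUnion]
    constructor
    · rintro ⟨c, i, u, hu, rfl⟩
      exact ⟨_, u, hu, rfl⟩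
    · rintro ⟨v, u, hu, rfl⟩
      obtain ⟨⟨c, i⟩, rfl⟩ := hΦ.2 v
      exact ⟨c, i, u, hu, rfl⟩
  · intro i j hij
    rw [himg, himg, disjoint_left]
    rintro p ⟨i', u, hu, rfl⟩ ⟨j', u', hu', h⟩
    have h1 := hΦ.1 (hinj _ _ u hu u' hu' h).1
    exact hij (e.injective (congrArg Sigma.fst h1))
  · intro f hf
    rw [e.surjective.iUnion_comp fun c => (γ c).image] at hf
    rw [e.sum_comp fun c => (γ c).integral f, ← hΦ.sum_comp, Fintype.sum_sigma]
    refine Finset.sum_congr rfl fun c _ => ?_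
    refine (integral_closedPolygon _ _ _ _
      (hf.mono (subset_iUnion (fun c => (γ c).image) c))).trans ?_
    rw [Finset.sum_range]
    refine Finset.sum_congr rfl fun i _ => ?_
    rw [hb]

/-! ### The winding number of a rectangle -/

theorem segmentIntegral_symm (p q : ℂ) (f : ℂ → ℂ) :
    segmentIntegral q p f = -segmentIntegral p q f := by
  have h := intervalIntegral.integral_comp_sub_left (a := 0) (b := 1)
    (fun u : ℝ => f (p + u * (q - p))) 1
  rw [sub_self, sub_zero] at h
  rw [segmentIntegral, segmentIntegral, ← h, ← neg_mul, neg_sub]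
  congr 1
  refine intervalIntegral.integral_congr fun u _ => ?_
  push_cast
  ring_nf

/-- If multiplication by `c` moves the segment, seen from `w`, off the branch cut, then the integral
of the Cauchy kernel is a difference of logarithms. -/
theorem segmentIntegral_inv_sub {p q w : ℂ} {c : ℂ}
    (h : ∀ u ∈ Icc (0 : ℝ) 1, c * (p + u * (q - p) - w) ∈ Complex.slitPlane) :
    segmentIntegral p q (fun z => (z - w)⁻¹) =
      Complex.log (c * (q - w)) - Complex.log (c * (p - w)) := by
  have hne : ∀ u ∈ Icc (0 : ℝ) 1, c ≠ 0 ∧ p + u * (q - p) - w ≠ 0 := fun u hu =>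
    mul_ne_zero_iff.1 (Complex.slitPlane_ne_zero (h u hu))
  have hd : ∀ u ∈ uIcc (0 : ℝ) 1, HasDerivAt
      (fun u : ℝ => Complex.log (c * (p + u * (q - p) - w)))
      ((q - p) * (p + u * (q - p) - w)⁻¹) u := by
    intro u hu
    rw [uIcc_of_le zero_le_one] at hu
    have h1 : HasDerivAt (fun u : ℝ => c * (p + u * (q - p) - w)) (c * (q - p)) u := by
      refine (((((hasDerivAt_id u).ofReal_comp.mul_const (q - p)).const_add p).sub_const
        w).const_mul c).congr_deriv ?_
      simp
    refine (h1.clog_real (h u hu)).congr_deriv ?_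
    rw [mul_div_mul_left _ _ (hne u hu).1, div_eq_mul_inv]
  have hc : ContinuousOn (fun u : ℝ => (q - p) * (p + u * (q - p) - w)⁻¹) (uIcc 0 1) := by
    rw [uIcc_of_le zero_le_one]
    exact continuousOn_const.mul (ContinuousOn.inv₀ (by fun_prop) fun u hu => (hne u hu).2)
  rw [segmentIntegral, ← intervalIntegral.integral_const_mul,
    intervalIntegral.integral_eq_sub_of_hasDerivAt hd hc.intervalIntegrable]
  simp

theorem segmentIntegral_inv_sub_of_re_pos {p q w : ℂ} (hp : w.re < p.re) (hq : w.re < q.re) :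
    segmentIntegral p q (fun z => (z - w)⁻¹) = Complex.log (q - w) - Complex.log (p - w) := by
  have := segmentIntegral_inv_sub (p := p) (q := q) (w := w) (c := 1) fun u hu => Or.inl (by
    simp only [one_mul, Complex.sub_re, Complex.add_re, Complex.re_ofReal_mul]
    nlinarith [hu.1, hu.2, mul_nonneg hu.1 (sub_nonneg.2 hq.le),
      mul_nonneg (sub_nonneg.2 hu.2) (sub_nonneg.2 hp.le)])
  simpa using this

theorem segmentIntegral_inv_sub_of_re_neg {p q w : ℂ} (hp : p.re < w.re) (hq : q.re < w.re) :
    segmentIntegral p q (fun z => (z - w)⁻¹) = Complex.log (w - q) - Complex.log (w - p) := by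
  have := segmentIntegral_inv_sub (p := p) (q := q) (w := w) (c := -1) fun u hu => Or.inl (by
    simp only [neg_mul, one_mul, Complex.neg_re, Complex.sub_re, Complex.add_re,
      Complex.re_ofReal_mul]
    nlinarith [hu.1, hu.2, mul_nonneg hu.1 (sub_nonneg.2 hq.le),
      mul_nonneg (sub_nonneg.2 hu.2) (sub_nonneg.2 hp.le)])
  simpa using this

theorem segmentIntegral_inv_sub_of_im_pos {p q w : ℂ} (hp : w.im < p.im) (hq : w.im < q.im) :
    segmentIntegral p q (fun z => (z - w)⁻¹) = Complex.log (q - w) - Complex.log (p - w) := by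
  have := segmentIntegral_inv_sub (p := p) (q := q) (w := w) (c := 1) fun u hu =>
    Or.inr (ne_of_gt (by
      simp only [one_mul, Complex.sub_im, Complex.add_im, Complex.im_ofReal_mul]
      nlinarith [hu.1, hu.2, mul_nonneg hu.1 (sub_nonneg.2 hq.le),
        mul_nonneg (sub_nonneg.2 hu.2) (sub_nonneg.2 hp.le)]))
  simpa using this

theorem segmentIntegral_inv_sub_of_im_neg {p q w : ℂ} (hp : p.im < w.im) (hq : q.im < w.im) :
    segmentIntegral p q (fun z => (z - w)⁻¹) = Complex.log (q - w) - Complex.log (p - w) := by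
  have := segmentIntegral_inv_sub (p := p) (q := q) (w := w) (c := 1) fun u hu =>
    Or.inr (ne_of_lt (by
      simp only [one_mul, Complex.sub_im, Complex.add_im, Complex.im_ofReal_mul]
      nlinarith [hu.1, hu.2, mul_nonneg hu.1 (sub_nonneg.2 hq.le),
        mul_nonneg (sub_nonneg.2 hu.2) (sub_nonneg.2 hp.le)]))
  simpa using this

/-- The integral of `f` counterclockwise along the boundary of `[x₀, x₁] × [y₀, y₁]`. -/
noncomputable def rectangleIntegral (x₀ x₁ y₀ y₁ : ℝ) (f : ℂ → ℂ) : ℂ :=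
  segmentIntegral ⟨x₀, y₀⟩ ⟨x₁, y₀⟩ f + segmentIntegral ⟨x₁, y₀⟩ ⟨x₁, y₁⟩ f -
    segmentIntegral ⟨x₀, y₁⟩ ⟨x₁, y₁⟩ f - segmentIntegral ⟨x₀, y₀⟩ ⟨x₀, y₁⟩ f

/-- Three sides of the rectangle are seen from `w` off the negative real axis; on the fourth the
opposite branch of the logarithm is used, and the two changes of branch contribute `πi` each. -/
theorem rectangleIntegral_inv_sub_of_mem {x₀ x₁ y₀ y₁ : ℝ} {w : ℂ}
    (hx : w.re ∈ Ioo x₀ x₁) (hy : w.im ∈ Ioo y₀ y₁) :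
    rectangleIntegral x₀ x₁ y₀ y₁ (fun z => (z - w)⁻¹) = 2 * Real.pi * Complex.I := by
  have h1 : Complex.log (w - ⟨x₀, y₁⟩) = Complex.log (⟨x₀, y₁⟩ - w) - Real.pi * Complex.I := by
    rw [← neg_sub, Complex.log, Complex.log, norm_neg,
      Complex.arg_neg_eq_arg_sub_pi_of_im_pos (by simpa using hy.2)]
    push_cast
    ring
  have h2 : Complex.log (w - ⟨x₀, y₀⟩) = Complex.log (⟨x₀, y₀⟩ - w) + Real.pi * Complex.I := by
    rw [← neg_sub, Complex.log, Complex.log, norm_neg,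
      Complex.arg_neg_eq_arg_add_pi_of_im_neg (by simpa using hy.1)]
    push_cast
    ring
  rw [rectangleIntegral, segmentIntegral_inv_sub_of_im_neg hy.1 hy.1,
    segmentIntegral_inv_sub_of_re_pos hx.2 hx.2, segmentIntegral_inv_sub_of_im_pos hy.2 hy.2,
    segmentIntegral_inv_sub_of_re_neg hx.1 hx.1, h1, h2]
  ring

theorem rectangleIntegral_inv_sub_of_notMem {x₀ x₁ y₀ y₁ : ℝ} {w : ℂ} (hx : x₀ ≤ x₁)
    (hy : y₀ ≤ y₁) (h : ¬(w.re ∈ Icc x₀ x₁ ∧ w.im ∈ Icc y₀ y₁)) :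
    rectangleIntegral x₀ x₁ y₀ y₁ (fun z => (z - w)⁻¹) = 0 := by
  have hcases : w.re < x₀ ∨ x₁ < w.re ∨ w.im < y₀ ∨ y₁ < w.im := by
    by_contra! hcon
    exact h ⟨⟨hcon.1, hcon.2.1⟩, hcon.2.2.1, hcon.2.2.2⟩
  rw [rectangleIntegral]
  rcases hcases with h | h | h | h
  · have h' := h.trans_le hx
    rw [segmentIntegral_inv_sub_of_re_pos h h', segmentIntegral_inv_sub_of_re_pos h' h',
      segmentIntegral_inv_sub_of_re_pos h h', segmentIntegral_inv_sub_of_re_pos h h]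
    ring
  · have h' := hx.trans_lt h
    rw [segmentIntegral_inv_sub_of_re_neg h' h, segmentIntegral_inv_sub_of_re_neg h h,
      segmentIntegral_inv_sub_of_re_neg h' h, segmentIntegral_inv_sub_of_re_neg h' h']
    ring
  · have h' := h.trans_le hy
    rw [segmentIntegral_inv_sub_of_im_pos h h, segmentIntegral_inv_sub_of_im_pos h h',
      segmentIntegral_inv_sub_of_im_pos h' h', segmentIntegral_inv_sub_of_im_pos h h']
    ring
  · have h' := hy.trans_lt h
    rw [segmentIntegral_inv_sub_of_im_neg h' h', segmentIntegral_inv_sub_of_im_neg h' h,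
      segmentIntegral_inv_sub_of_im_neg h h, segmentIntegral_inv_sub_of_im_neg h' h]
    ring

/-! ### Regions composed of cells of a square grid -/

/-- The vertex of the square grid of mesh `δ` with integer coordinates `v`. -/
def gridPoint (δ : ℝ) (v : ℤ × ℤ) : ℂ := ⟨δ * v.1, δ * v.2⟩

/-- The closed cell of the square grid of mesh `δ` whose lower left vertex is `gridPoint δ c`. -/
def closedCell (δ : ℝ) (c : ℤ × ℤ) : Set ℂ :=
  Icc (δ * c.1) (δ * (c.1 + 1)) ×ℂ Icc (δ * c.2) (δ * (c.2 + 1))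

/-- The interior of `closedCell δ c`. -/
def openCell (δ : ℝ) (c : ℤ × ℤ) : Set ℂ :=
  Ioo (δ * c.1) (δ * (c.1 + 1)) ×ℂ Ioo (δ * c.2) (δ * (c.2 + 1))

/-- The union of the closed cells in `R`. -/
def gridRegion (δ : ℝ) (R : Finset (ℤ × ℤ)) : Set ℂ := ⋃ c ∈ R, closedCell δ c

/-- The points that lie only in cells of `R`; this is the interior of `gridRegion δ R`. -/
def gridInterior (δ : ℝ) (R : Finset (ℤ × ℤ)) : Set ℂ := {p | ∀ c, p ∈ closedCell δ c → c ∈ R}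

/-- Two cells of `R` that share a vertex, but no edge, have a common neighbour in `R`. -/
def NoCheckerboard (R : Finset (ℤ × ℤ)) : Prop :=
  ∀ x y : ℤ, ((x, y) ∈ R → (x - 1, y - 1) ∈ R → (x - 1, y) ∈ R ∨ (x, y - 1) ∈ R) ∧
    ((x - 1, y) ∈ R → (x, y - 1) ∈ R → (x, y) ∈ R ∨ (x - 1, y - 1) ∈ R)

section Grid

variable {δ : ℝ} {R : Finset (ℤ × ℤ)}

theorem mem_Icc_grid_iff (hδ : 0 < δ) {m n : ℤ} {a : ℝ} (ha : a ∈ Ico (0 : ℝ) 1) :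
    δ * (m + a) ∈ Icc (δ * n) (δ * (n + 1)) ↔ n = m ∨ a = 0 ∧ n = m - 1 := by
  rw [mem_Icc, mul_le_mul_iff_right₀ hδ, mul_le_mul_iff_right₀ hδ]
  constructor
  · rintro ⟨h1, h2⟩
    have h3 : (n : ℝ) < m + 1 := by linarith [ha.2]
    have h4 : (m : ℝ) ≤ n + 1 := by linarith [ha.1]
    norm_cast at h3 h4
    rcases (show n = m ∨ n = m - 1 by omega) with h | h
    · exact Or.inl h
    · refine Or.inr ⟨le_antisymm ?_ ha.1, h⟩
      have : (n : ℝ) = m - 1 := by rw [h]; push_cast; ring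
      linarith
  · rintro (rfl | ⟨rfl, rfl⟩)
    · constructor <;> linarith [ha.1, ha.2]
    · constructor <;> push_cast <;> linarith

theorem mem_closedCell_iff (hδ : 0 < δ) {x y : ℤ} {a b : ℝ} (ha : a ∈ Ico (0 : ℝ) 1)
    (hb : b ∈ Ico (0 : ℝ) 1) {c : ℤ × ℤ} :
    (⟨δ * (x + a), δ * (y + b)⟩ : ℂ) ∈ closedCell δ c ↔
      (c.1 = x ∨ a = 0 ∧ c.1 = x - 1) ∧ (c.2 = y ∨ b = 0 ∧ c.2 = y - 1) := by
  rw [closedCell, Complex.mem_reProdIm, mem_Icc_grid_iff hδ ha, mem_Icc_grid_iff hδ hb]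

theorem exists_grid_coord (hδ : 0 < δ) (s : ℝ) : ∃ m : ℤ, ∃ a ∈ Ico (0 : ℝ) 1, s = δ * (m + a) := by
  refine ⟨⌊s / δ⌋, Int.fract (s / δ), ⟨Int.fract_nonneg _, Int.fract_lt_one _⟩, ?_⟩
  rw [Int.floor_add_fract, mul_div_cancel₀ _ hδ.ne']

theorem exists_grid_coords (hδ : 0 < δ) (p : ℂ) : ∃ x y : ℤ, ∃ a ∈ Ico (0 : ℝ) 1,
    ∃ b ∈ Ico (0 : ℝ) 1, p = ⟨δ * (x + a), δ * (y + b)⟩ := by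
  obtain ⟨x, a, ha, h⟩ := exists_grid_coord hδ p.re
  obtain ⟨y, b, hb, h'⟩ := exists_grid_coord hδ p.im
  exact ⟨x, y, a, ha, b, hb, Complex.ext h h'⟩

theorem exists_mem_closedCell (hδ : 0 < δ) (p : ℂ) : ∃ c, p ∈ closedCell δ c := by
  obtain ⟨x, y, a, ha, b, hb, rfl⟩ := exists_grid_coords hδ p
  exact ⟨(x, y), (mem_closedCell_iff hδ ha hb).2 ⟨Or.inl rfl, Or.inl rfl⟩⟩

theorem openCell_subset_closedCell (c : ℤ × ℤ) : openCell δ c ⊆ closedCell δ c := fun _ hp =>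
  ⟨Ioo_subset_Icc_self hp.1, Ioo_subset_Icc_self hp.2⟩

theorem closure_openCell (hδ : 0 < δ) (c : ℤ × ℤ) : closure (openCell δ c) = closedCell δ c := by
  rw [openCell, Complex.closure_reProdIm, closure_Ioo, closure_Ioo, closedCell] <;>
  · rw [Ne, mul_right_inj' hδ.ne']
    linarith

theorem eq_of_mem_Ioo_grid (hδ : 0 < δ) {m n : ℤ} {s : ℝ} (h : s ∈ Ioo (δ * m) (δ * (m + 1)))
    (h' : s ∈ Icc (δ * n) (δ * (n + 1))) : n = m := by
  have h1 : (n : ℝ) < m + 1 := lt_of_mul_lt_mul_left (h'.1.trans_lt h.2) hδ.le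
  have h2 : (m : ℝ) < n + 1 := lt_of_mul_lt_mul_left (h.1.trans_le h'.2) hδ.le
  norm_cast at h1 h2
  omega

theorem eq_of_mem_openCell (hδ : 0 < δ) {c c' : ℤ × ℤ} {p : ℂ} (h : p ∈ openCell δ c)
    (h' : p ∈ closedCell δ c') : c' = c :=
  Prod.ext (eq_of_mem_Ioo_grid hδ h.1 h'.1) (eq_of_mem_Ioo_grid hδ h.2 h'.2)

theorem dense_iUnion_openCell (hδ : 0 < δ) : Dense (⋃ c, openCell δ c) := by
  intro p
  obtain ⟨c, hc⟩ := exists_mem_closedCell hδ p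
  rw [← closure_openCell hδ] at hc
  exact closure_mono (subset_iUnion _ c) hc

theorem eventually_mem_Icc_grid (hδ : 0 < δ) (s : ℝ) :
    ∀ᶠ t in 𝓝 s, ∀ n : ℤ, t ∈ Icc (δ * n) (δ * (n + 1)) → s ∈ Icc (δ * n) (δ * (n + 1)) := by
  have h1 : s < δ * (⌊s / δ⌋ + 1) := by
    rw [← div_lt_iff₀' hδ]
    exact Int.lt_floor_add_one _
  have h2 : δ * (⌈s / δ⌉ - 1) < s := by
    rw [← lt_div_iff₀' hδ]
    linarith [Int.ceil_lt_add_one (s / δ)]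
  filter_upwards [Ioo_mem_nhds h2 h1] with t ht n hn
  have h3 : (n : ℝ) < ⌊s / δ⌋ + 1 := lt_of_mul_lt_mul_left (hn.1.trans_lt ht.2) hδ.le
  have h4 : (⌈s / δ⌉ : ℝ) - 1 < n + 1 := lt_of_mul_lt_mul_left (ht.1.trans_le hn.2) hδ.le
  constructor
  · rw [← le_div_iff₀' hδ]
    exact Int.le_floor.1 (by exact_mod_cast Int.lt_add_one_iff.1 (by exact_mod_cast h3))
  · rw [← div_le_iff₀' hδ]
    have : ⌈s / δ⌉ ≤ n + 1 := by
      have h5 : (⌈s / δ⌉ : ℝ) < (n + 2 : ℤ) := by push_cast; linarith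
      have := Int.cast_lt.1 h5
      omega
    exact_mod_cast Int.ceil_le.1 this

/-- Near a point only those cells are met that contain the point. -/
theorem eventually_mem_closedCell (hδ : 0 < δ) (p : ℂ) :
    ∀ᶠ q in 𝓝 p, ∀ c, q ∈ closedCell δ c → p ∈ closedCell δ c := by
  filter_upwards [Complex.continuous_re.continuousAt.eventually (eventually_mem_Icc_grid hδ p.re),
    Complex.continuous_im.continuousAt.eventually (eventually_mem_Icc_grid hδ p.im)]
    with q h1 h2 c hc using ⟨h1 _ hc.1, h2 _ hc.2⟩

theorem isOpen_gridInterior (hδ : 0 < δ) : IsOpen (gridInterior δ R) := by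
  rw [isOpen_iff_mem_nhds]
  intro p hp
  filter_upwards [eventually_mem_closedCell hδ p] with q hq c hc using hp c (hq c hc)

theorem isCompact_gridRegion : IsCompact (gridRegion δ R) :=
  R.isCompact_biUnion fun _ _ => isCompact_Icc.reProdIm isCompact_Icc

theorem mem_gridRegion_iff {p : ℂ} : p ∈ gridRegion δ R ↔ ∃ c ∈ R, p ∈ closedCell δ c := by
  simp [gridRegion]

theorem gridInterior_subset_gridRegion (hδ : 0 < δ) : gridInterior δ R ⊆ gridRegion δ R := by
  intro p hp
  obtain ⟨c, hc⟩ := exists_mem_closedCell hδ p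
  exact mem_gridRegion_iff.2 ⟨c, hp c hc, hc⟩

theorem openCell_subset_gridInterior (hδ : 0 < δ) {c : ℤ × ℤ} (hc : c ∈ R) :
    openCell δ c ⊆ gridInterior δ R := by
  intro p hp c' hc'
  rwa [eq_of_mem_openCell hδ hp hc']

theorem closure_gridInterior (hδ : 0 < δ) : closure (gridInterior δ R) = gridRegion δ R := by
  refine (closure_minimal (gridInterior_subset_gridRegion hδ)
    isCompact_gridRegion.isClosed).antisymm fun p hp => ?_
  obtain ⟨c, hc, hpc⟩ := mem_gridRegion_iff.1 hp
  rw [← closure_openCell hδ] at hpc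
  exact closure_mono (openCell_subset_gridInterior hδ hc) hpc

/-! ### Components of the interior of a grid region -/

/-- The centre of a cell. -/
noncomputable def cellCenter (δ : ℝ) (c : ℤ × ℤ) : ℂ := ⟨δ * (c.1 + 1 / 2), δ * (c.2 + 1 / 2)⟩

theorem cellCenter_mem_openCell (hδ : 0 < δ) (c : ℤ × ℤ) : cellCenter δ c ∈ openCell δ c := by
  refine ⟨⟨?_, ?_⟩, ⟨?_, ?_⟩⟩ <;> refine mul_lt_mul_of_pos_left ?_ hδ <;> norm_num

theorem isPreconnected_Ioo_reProdIm_Ioo (a b c d : ℝ) :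
    IsPreconnected (Ioo a b ×ℂ Ioo c d) :=
  (((convex_Ioo a b).is_linear_preimage Complex.reLm.isLinear).inter
    ((convex_Ioo c d).is_linear_preimage Complex.imLm.isLinear)).isPreconnected

/-- Near any point of its closure, a component of the interior contains an entire open cell. -/
theorem IsComponent.exists_cell (hδ : 0 < δ) {C : Set ℂ} (hC : IsComponent C (gridInterior δ R))
    {p : ℂ} (hp : p ∈ closure C) : ∃ c ∈ R, p ∈ closedCell δ c ∧
      C = connectedComponentIn (gridInterior δ R) (cellCenter δ c) := by
  obtain ⟨z, -, rfl⟩ := hC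
  obtain ⟨U, hU, hUo, hpU⟩ := eventually_nhds_iff.1 (eventually_mem_closedCell hδ p)
  have hne : (U ∩ connectedComponentIn (gridInterior δ R) z).Nonempty :=
    mem_closure_iff.1 hp U hUo hpU
  obtain ⟨q, ⟨hqU, hqC⟩, hq⟩ := (dense_iUnion_openCell hδ).inter_open_nonempty _
    (hUo.inter (isOpen_gridInterior hδ).connectedComponentIn) hne
  obtain ⟨c, hqc⟩ := mem_iUnion.1 hq
  have hqc' := openCell_subset_closedCell c hqc
  have hcR : c ∈ R := connectedComponentIn_subset _ _ hqC c hqc'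
  refine ⟨c, hcR, hU q hqU c hqc', ?_⟩
  rw [connectedComponentIn_eq hqC]
  refine connectedComponentIn_eq ?_
  exact (isPreconnected_Ioo_reProdIm_Ioo _ _ _ _).subset_connectedComponentIn hqc
    (openCell_subset_gridInterior hδ hcR) (cellCenter_mem_openCell hδ c)

theorem connectedComponentIn_eq_of_add_one_fst (hδ : 0 < δ) {x y : ℤ} (h : (x, y) ∈ R)
    (h' : (x + 1, y) ∈ R) : connectedComponentIn (gridInterior δ R) (cellCenter δ (x, y)) =
      connectedComponentIn (gridInterior δ R) (cellCenter δ (x + 1, y)) := by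
  refine connectedComponentIn_eq ((isPreconnected_Ioo_reProdIm_Ioo (δ * x) (δ * (x + 2))
    (δ * y) (δ * (y + 1))).subset_connectedComponentIn ?_ ?_ ?_)
  · refine ⟨⟨?_, ?_⟩, ⟨?_, ?_⟩⟩ <;> refine mul_lt_mul_of_pos_left ?_ hδ <;> norm_num
  · rintro p ⟨hp1, hp2⟩ ⟨x', y'⟩ ⟨hc1, hc2⟩
    obtain rfl : y' = y := eq_of_mem_Ioo_grid hδ hp2 hc2
    have h1 : (x' : ℝ) < x + 2 := lt_of_mul_lt_mul_left (hc1.1.trans_lt hp1.2) hδ.le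
    have h2 : (x : ℝ) < x' + 1 := lt_of_mul_lt_mul_left (hp1.1.trans_le hc1.2) hδ.le
    norm_cast at h1 h2
    rcases (show x' = x ∨ x' = x + 1 by omega) with rfl | rfl
    exacts [h, h']
  · refine ⟨⟨?_, ?_⟩, ⟨?_, ?_⟩⟩ <;> refine mul_lt_mul_of_pos_left ?_ hδ <;> push_cast <;> linarith

theorem connectedComponentIn_eq_of_add_one_snd (hδ : 0 < δ) {x y : ℤ} (h : (x, y) ∈ R)
    (h' : (x, y + 1) ∈ R) : connectedComponentIn (gridInterior δ R) (cellCenter δ (x, y)) =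
      connectedComponentIn (gridInterior δ R) (cellCenter δ (x, y + 1)) := by
  refine connectedComponentIn_eq ((isPreconnected_Ioo_reProdIm_Ioo (δ * x) (δ * (x + 1))
    (δ * y) (δ * (y + 2))).subset_connectedComponentIn ?_ ?_ ?_)
  · refine ⟨⟨?_, ?_⟩, ⟨?_, ?_⟩⟩ <;> refine mul_lt_mul_of_pos_left ?_ hδ <;> norm_num
  · rintro p ⟨hp1, hp2⟩ ⟨x', y'⟩ ⟨hc1, hc2⟩
    obtain rfl : x' = x := eq_of_mem_Ioo_grid hδ hp1 hc1
    have h1 : (y' : ℝ) < y + 2 := lt_of_mul_lt_mul_left (hc2.1.trans_lt hp2.2) hδ.le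
    have h2 : (y : ℝ) < y' + 1 := lt_of_mul_lt_mul_left (hp2.1.trans_le hc2.2) hδ.le
    norm_cast at h1 h2
    rcases (show y' = y ∨ y' = y + 1 by omega) with rfl | rfl
    exacts [h, h']
  · refine ⟨⟨?_, ?_⟩, ⟨?_, ?_⟩⟩ <;> refine mul_lt_mul_of_pos_left ?_ hδ <;> push_cast <;> linarith

/-- Two cells of `R` with a common point lie in the same component of the interior. -/
theorem connectedComponentIn_eq_of_mem_closedCell (hδ : 0 < δ) (hR : NoCheckerboard R)
    {c c' : ℤ × ℤ} (hc : c ∈ R) (hc' : c' ∈ R) {p : ℂ} (hp : p ∈ closedCell δ c)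
    (hp' : p ∈ closedCell δ c') : connectedComponentIn (gridInterior δ R) (cellCenter δ c) =
      connectedComponentIn (gridInterior δ R) (cellCenter δ c') := by
  obtain ⟨F, hF⟩ : ∃ F : ℤ × ℤ → Set ℂ, ∀ c,
      F c = connectedComponentIn (gridInterior δ R) (cellCenter δ c) := ⟨_, fun _ => rfl⟩
  rw [← hF, ← hF]
  have h1 : ∀ x y, (x, y) ∈ R → (x - 1, y) ∈ R → F (x - 1, y) = F (x, y) := fun x y h h' => by
    have := connectedComponentIn_eq_of_add_one_fst hδ h' (by rwa [sub_add_cancel])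
    rwa [sub_add_cancel, ← hF, ← hF] at this
  have h2 : ∀ x y, (x, y) ∈ R → (x, y - 1) ∈ R → F (x, y - 1) = F (x, y) := fun x y h h' => by
    have := connectedComponentIn_eq_of_add_one_snd hδ h' (by rwa [sub_add_cancel])
    rwa [sub_add_cancel, ← hF, ← hF] at this
  clear hF
  obtain ⟨x, y, a, ha, b, hb, rfl⟩ := exists_grid_coords hδ p
  rw [mem_closedCell_iff hδ ha hb] at hp hp'
  -- the only nontrivial case is that of two diagonally opposite cells at a vertex
  have hd1 : (x, y) ∈ R → (x - 1, y - 1) ∈ R → F (x, y) = F (x - 1, y - 1) := fun hc hc' => by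
    rcases (hR x y).1 hc hc' with h | h
    · rw [← h1 x y hc h, ← h2 (x - 1) y h hc']
    · rw [← h2 x y hc h, ← h1 x (y - 1) h hc']
  have hd2 : (x - 1, y) ∈ R → (x, y - 1) ∈ R → F (x - 1, y) = F (x, y - 1) := fun hc hc' => by
    rcases (hR x y).2 hc hc' with h | h
    · rw [h1 x y h hc, ← h2 x y h hc']
    · rw [← h2 (x - 1) y hc h, h1 x (y - 1) hc' h]
  replace h1' := h1 x (y - 1)
  replace h2' := h2 (x - 1) y
  replace h1 := h1 x y
  replace h2 := h2 x y
  obtain ⟨cx, cy⟩ := c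
  obtain ⟨cx', cy'⟩ := c'
  dsimp only at hp hp'
  have hcx : cx = x ∨ cx = x - 1 := hp.1.imp_right And.right
  have hcy : cy = y ∨ cy = y - 1 := hp.2.imp_right And.right
  have hcx' : cx' = x ∨ cx' = x - 1 := hp'.1.imp_right And.right
  have hcy' : cy' = y ∨ cy' = y - 1 := hp'.2.imp_right And.right
  clear hp hp' ha hb hR
  rcases hcx with rfl | rfl <;> rcases hcy with rfl | rfl <;> rcases hcx' with rfl | rfl <;>
    rcases hcy' with rfl | rfl <;> grind only

theorem finite_components_gridInterior (hδ : 0 < δ) :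
    {C : Set ℂ | IsComponent C (gridInterior δ R)}.Finite := by
  refine (R.finite_toSet.image fun c =>
    connectedComponentIn (gridInterior δ R) (cellCenter δ c)).subset fun C hC => ?_
  obtain ⟨z, hz, rfl⟩ := id hC
  obtain ⟨c, hc, -, h⟩ := IsComponent.exists_cell hδ hC
    (subset_closure (mem_connectedComponentIn hz))
  exact ⟨c, hc, h.symm⟩

theorem disjoint_closure_components (hδ : 0 < δ) (hR : NoCheckerboard R) {C C' : Set ℂ}
    (hC : IsComponent C (gridInterior δ R)) (hC' : IsComponent C' (gridInterior δ R))
    (hne : C ≠ C') : Disjoint (closure C) (closure C') := by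
  rw [disjoint_left]
  intro p hp hp'
  obtain ⟨c, hc, hpc, rfl⟩ := hC.exists_cell hδ hp
  obtain ⟨c', hc', hpc', rfl⟩ := hC'.exists_cell hδ hp'
  exact hne (connectedComponentIn_eq_of_mem_closedCell hδ hR hc hc' hpc hpc')

/-! ### The oriented boundary of a grid region -/

/-- There is a grid edge from `v` to `w` with a cell of `R` on its left and none on its right. -/
def BoundaryEdge (R : Finset (ℤ × ℤ)) (v w : ℤ × ℤ) : Prop :=
  (w = (v.1 + 1, v.2) ∧ (v.1, v.2) ∈ R ∧ (v.1, v.2 - 1) ∉ R) ∨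
  (w = (v.1, v.2 + 1) ∧ (v.1 - 1, v.2) ∈ R ∧ (v.1, v.2) ∉ R) ∨
  (w = (v.1 - 1, v.2) ∧ (v.1 - 1, v.2 - 1) ∈ R ∧ (v.1 - 1, v.2) ∉ R) ∨
  (w = (v.1, v.2 - 1) ∧ (v.1, v.2 - 1) ∈ R ∧ (v.1 - 1, v.2 - 1) ∉ R)

namespace BoundaryEdge

theorem right_unique (hR : NoCheckerboard R) {v w w' : ℤ × ℤ} (h : BoundaryEdge R v w)
    (h' : BoundaryEdge R v w') : w = w' := by
  obtain ⟨x, y⟩ := v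
  have := hR x y
  simp only [BoundaryEdge] at h h'
  grind only

theorem left_unique (hR : NoCheckerboard R) {v v' w : ℤ × ℤ} (h : BoundaryEdge R v w)
    (h' : BoundaryEdge R v' w) : v = v' := by
  obtain ⟨x, y⟩ := w
  have := hR x y
  obtain ⟨a, b⟩ := v
  obtain ⟨c, d⟩ := v'
  simp only [BoundaryEdge, Prod.mk.injEq] at h h'
  rcases h with ⟨⟨h1, h2⟩, h⟩ | ⟨⟨h1, h2⟩, h⟩ | ⟨⟨h1, h2⟩, h⟩ | ⟨⟨h1, h2⟩, h⟩ <;>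
  rcases h' with ⟨⟨h1', h2'⟩, h'⟩ | ⟨⟨h1', h2'⟩, h'⟩ | ⟨⟨h1', h2'⟩, h'⟩ | ⟨⟨h1', h2'⟩, h'⟩ <;>
  grind only

theorem exists_next {v w : ℤ × ℤ} (h : BoundaryEdge R v w) : ∃ w', BoundaryEdge R w w' := by
  obtain ⟨x, y⟩ := w
  obtain ⟨a, b⟩ := v
  by_contra! hcon
  have e1 := hcon (x + 1, y)
  have e2 := hcon (x, y + 1)
  have e3 := hcon (x - 1, y)
  have e4 := hcon (x, y - 1)
  simp only [BoundaryEdge, Prod.mk.injEq] at h e1 e2 e3 e4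
  rcases h with ⟨⟨h1, h2⟩, h⟩ | ⟨⟨h1, h2⟩, h⟩ | ⟨⟨h1, h2⟩, h⟩ | ⟨⟨h1, h2⟩, h⟩ <;>
  grind only

end BoundaryEdge

theorem int_add_eq_int_add {m n : ℤ} {u v : ℝ} (hu : u ∈ Ico (0 : ℝ) 1) (hv : v ∈ Ico (0 : ℝ) 1)
    (h : (m : ℝ) + u = n + v) : m = n ∧ u = v := by
  have h1 : (m : ℝ) < n + 1 := by linarith [hu.1, hv.2]
  have h2 : (n : ℝ) < m + 1 := by linarith [hu.2, hv.1]
  norm_cast at h1 h2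
  obtain rfl : m = n := by omega
  exact ⟨rfl, by linarith⟩

/-- A point of the half-open edge from `v` to `w`, by its coordinates. -/
theorem gridPoint_add_mul (v w : ℤ × ℤ) (u : ℝ) :
    gridPoint δ v + u * (gridPoint δ w - gridPoint δ v) =
      ⟨δ * (v.1 + u * (w.1 - v.1)), δ * (v.2 + u * (w.2 - v.2))⟩ := by
  apply Complex.ext
  · simp [gridPoint]
    ring
  · simp [gridPoint]
    ring

/-- The point at parameter `u` of the boundary edge that starts at `v` is offset by
`(a, b)`, in units of the mesh, from the vertex `(x, y)` of the grid: it is that vertex, or an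
interior point of the unit edge to the right of it, or of the unit edge above it. -/
def EdgePoint (R : Finset (ℤ × ℤ)) (v : ℤ × ℤ) (u : ℝ) (x y : ℤ) (a b : ℝ) : Prop :=
  (a = 0 ∧ b = 0 ∧ u = 0 ∧ v = (x, y)) ∨
  (0 < a ∧ b = 0 ∧ ((v = (x, y) ∧ u = a ∧ (x, y) ∈ R ∧ (x, y - 1) ∉ R) ∨
    (v = (x + 1, y) ∧ u = 1 - a ∧ (x, y - 1) ∈ R ∧ (x, y) ∉ R))) ∨
  (a = 0 ∧ 0 < b ∧ ((v = (x, y) ∧ u = b ∧ (x - 1, y) ∈ R ∧ (x, y) ∉ R) ∨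
    (v = (x, y + 1) ∧ u = 1 - b ∧ (x, y) ∈ R ∧ (x - 1, y) ∉ R)))

theorem BoundaryEdge.exists_edgePoint {v w : ℤ × ℤ} (h : BoundaryEdge R v w) {u : ℝ}
    (hu : u ∈ Ico (0 : ℝ) 1) : ∃ x y : ℤ, ∃ a ∈ Ico (0 : ℝ) 1, ∃ b ∈ Ico (0 : ℝ) 1,
      gridPoint δ v + u * (gridPoint δ w - gridPoint δ v) = ⟨δ * (x + a), δ * (y + b)⟩ ∧
        EdgePoint R v u x y a b := by
  obtain ⟨x, y⟩ := v
  have h0 : (0 : ℝ) ∈ Ico (0 : ℝ) 1 := by simp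
  simp only [gridPoint_add_mul, Complex.mk.injEq]
  rcases hu.1.eq_or_lt with rfl | hu0
  · exact ⟨x, y, 0, h0, 0, h0, by simp, Or.inl ⟨rfl, rfl, rfl, rfl⟩⟩
  have hu' : 1 - u ∈ Ico (0 : ℝ) 1 := ⟨by linarith [hu.2], by linarith⟩
  have hu1 : 0 < 1 - u := by linarith [hu.2]
  rcases h with ⟨rfl, h1, h2⟩ | ⟨rfl, h1, h2⟩ | ⟨rfl, h1, h2⟩ | ⟨rfl, h1, h2⟩ <;>
    dsimp only at h1 h2
  · exact ⟨x, y, u, hu, 0, h0, by push_cast; constructor <;> ring,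
      Or.inr (Or.inl ⟨hu0, rfl, Or.inl ⟨rfl, rfl, h1, h2⟩⟩)⟩
  · exact ⟨x, y, 0, h0, u, hu, by push_cast; constructor <;> ring,
      Or.inr (Or.inr ⟨rfl, hu0, Or.inl ⟨rfl, rfl, h1, h2⟩⟩)⟩
  · exact ⟨x - 1, y, 1 - u, hu', 0, h0, by push_cast; constructor <;> ring,
      Or.inr (Or.inl ⟨hu1, rfl, Or.inr ⟨by simp, by ring, h1, h2⟩⟩)⟩
  · exact ⟨x, y - 1, 0, h0, 1 - u, hu', by push_cast; constructor <;> ring,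
      Or.inr (Or.inr ⟨rfl, hu1, Or.inr ⟨by simp, by ring, h1, h2⟩⟩)⟩

theorem EdgePoint.unique {v v' : ℤ × ℤ} {u u' a b : ℝ} {x y : ℤ} (h : EdgePoint R v u x y a b)
    (h' : EdgePoint R v' u' x y a b) : v = v' ∧ u = u' := by
  rcases h with ⟨rfl, rfl, rfl, rfl⟩ | ⟨ha, rfl, h⟩ | ⟨rfl, hb, h⟩
  · rcases h' with ⟨-, -, rfl, rfl⟩ | ⟨ha, -⟩ | ⟨-, hb, -⟩
    exacts [⟨rfl, rfl⟩, absurd ha (lt_irrefl _), absurd hb (lt_irrefl _)]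
  · rcases h' with ⟨rfl, -⟩ | ⟨-, -, h'⟩ | ⟨rfl, -⟩
    · exact absurd ha (lt_irrefl _)
    · rcases h with ⟨rfl, rfl, h1, h2⟩ | ⟨rfl, rfl, h1, h2⟩ <;>
      rcases h' with ⟨rfl, rfl, h1', h2'⟩ | ⟨rfl, rfl, h1', h2'⟩ <;>
      first | exact ⟨rfl, rfl⟩ | contradiction
    · exact absurd ha (lt_irrefl _)
  · rcases h' with ⟨-, rfl, -⟩ | ⟨-, rfl, -⟩ | ⟨-, -, h'⟩
    · exact absurd hb (lt_irrefl _)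
    · exact absurd hb (lt_irrefl _)
    · rcases h with ⟨rfl, rfl, h1, h2⟩ | ⟨rfl, rfl, h1, h2⟩ <;>
      rcases h' with ⟨rfl, rfl, h1', h2'⟩ | ⟨rfl, rfl, h1', h2'⟩ <;>
      first | exact ⟨rfl, rfl⟩ | contradiction

/-- The half-open boundary edges do not meet. -/
theorem BoundaryEdge.eq_of_point_eq (hδ : 0 < δ) {v w v' w' : ℤ × ℤ} (h : BoundaryEdge R v w)
    (h' : BoundaryEdge R v' w') {u u' : ℝ} (hu : u ∈ Ico (0 : ℝ) 1) (hu' : u' ∈ Ico (0 : ℝ) 1)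
    (heq : gridPoint δ v + u * (gridPoint δ w - gridPoint δ v) =
      gridPoint δ v' + u' * (gridPoint δ w' - gridPoint δ v')) : v = v' ∧ u = u' := by
  obtain ⟨x, y, a, ha, b, hb, hp, he⟩ := h.exists_edgePoint (δ := δ) hu
  obtain ⟨x', y', a', ha', b', hb', hp', he'⟩ := h'.exists_edgePoint (δ := δ) hu'
  rw [hp, hp', Complex.mk.injEq, mul_right_inj' hδ.ne', mul_right_inj' hδ.ne'] at heq
  obtain ⟨rfl, rfl⟩ := int_add_eq_int_add ha ha' heq.1
  obtain ⟨rfl, rfl⟩ := int_add_eq_int_add hb hb' heq.2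
  exact he.unique he'

/-- The boundary edges cover exactly the points that lie both in a cell of `R` and in a cell outside
of `R`. -/
theorem mem_region_diff_interior_iff (hδ : 0 < δ) {p : ℂ} :
    p ∈ gridRegion δ R \ gridInterior δ R ↔ ∃ v w, BoundaryEdge R v w ∧ ∃ u ∈ Ico (0 : ℝ) 1,
      p = gridPoint δ v + u * (gridPoint δ w - gridPoint δ v) := by
  have hmem : p ∈ gridRegion δ R \ gridInterior δ R ↔
      (∃ c ∈ R, p ∈ closedCell δ c) ∧ ∃ c, p ∈ closedCell δ c ∧ c ∉ R := by
    rw [Set.mem_sdiff, mem_gridRegion_iff]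
    refine and_congr_right fun _ => ?_
    change ¬ (∀ c, p ∈ closedCell δ c → c ∈ R) ↔ _
    push Not
    rfl
  rw [hmem]
  constructor
  · rintro ⟨⟨⟨cx, cy⟩, hc, hpc⟩, ⟨cx', cy'⟩, hpc', hc'⟩
    obtain ⟨x, y, a, ha, b, hb, rfl⟩ := exists_grid_coords hδ p
    rw [mem_closedCell_iff hδ ha hb] at hpc hpc'
    simp only [gridPoint_add_mul]
    dsimp only at hpc hpc'
    rcases ha.1.eq_or_lt with rfl | ha0 <;> rcases hb.1.eq_or_lt with rfl | hb0
    · -- a vertex: one of the four possible edges starts here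
      have hx : cx = x ∨ cx = x - 1 := hpc.1.imp_right And.right
      have hy : cy = y ∨ cy = y - 1 := hpc.2.imp_right And.right
      have hx' : cx' = x ∨ cx' = x - 1 := hpc'.1.imp_right And.right
      have hy' : cy' = y ∨ cy' = y - 1 := hpc'.2.imp_right And.right
      obtain ⟨w, hw⟩ : ∃ w, BoundaryEdge R (x, y) w := by
        by_contra! hcon
        have e1 := hcon (x + 1, y)
        have e2 := hcon (x, y + 1)
        have e3 := hcon (x - 1, y)
        have e4 := hcon (x, y - 1)
        clear hcon hpc hpc' hmem
        simp only [BoundaryEdge, Prod.mk.injEq] at e1 e2 e3 e4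
        rcases hx with rfl | rfl <;> rcases hy with rfl | rfl <;> rcases hx' with rfl | rfl <;>
          rcases hy' with rfl | rfl <;> grind only
      exact ⟨(x, y), w, hw, 0, ha, by simp⟩
    · have hy : cy = y := hpc.2.resolve_right fun h => hb0.ne' h.1
      have hy' : cy' = y := hpc'.2.resolve_right fun h => hb0.ne' h.1
      subst hy hy'
      rcases hpc.1 with rfl | ⟨-, rfl⟩ <;> rcases hpc'.1 with rfl | ⟨-, rfl⟩
      · exact absurd hc hc'
      · exact ⟨(cx, cy' + 1), (cx, cy' + 1 - 1),
          Or.inr (Or.inr (Or.inr ⟨rfl, by simpa using hc, by simpa using hc'⟩)), 1 - b,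
          ⟨by linarith [hb.2], by linarith⟩, by
            simp only [Complex.mk.injEq]
            push_cast
            constructor <;> ring⟩
      · exact ⟨(cx', cy'), (cx', cy' + 1), Or.inr (Or.inl ⟨rfl, hc, hc'⟩), b, hb, by
            simp only [Complex.mk.injEq]
            push_cast
            constructor <;> ring⟩
      · exact absurd hc hc'
    · have hx : cx = x := hpc.1.resolve_right fun h => ha0.ne' h.1
      have hx' : cx' = x := hpc'.1.resolve_right fun h => ha0.ne' h.1
      subst hx hx'
      rcases hpc.2 with rfl | ⟨-, rfl⟩ <;> rcases hpc'.2 with rfl | ⟨-, rfl⟩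
      · exact absurd hc hc'
      · exact ⟨(cx', cy), (cx' + 1, cy), Or.inl ⟨rfl, hc, hc'⟩, a, ha, by
            simp only [Complex.mk.injEq]
            push_cast
            constructor <;> ring⟩
      · exact ⟨(cx' + 1, cy'), (cx' + 1 - 1, cy'),
          Or.inr (Or.inr (Or.inl ⟨rfl, by simpa using hc, by simpa using hc'⟩)), 1 - a,
          ⟨by linarith [ha.2], by linarith⟩, by
            simp only [Complex.mk.injEq]
            push_cast
            constructor <;> ring⟩
      · exact absurd hc hc'
    · have h1 : (cx, cy) = (cx', cy') := by
        rw [hpc.1.resolve_right fun h => ha0.ne' h.1, hpc.2.resolve_right fun h => hb0.ne' h.1,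
          hpc'.1.resolve_right fun h => ha0.ne' h.1, hpc'.2.resolve_right fun h => hb0.ne' h.1]
      exact absurd (h1 ▸ hc) hc'
  · rintro ⟨⟨x, y⟩, w, h, u, hu, rfl⟩
    have h0 : (0 : ℝ) ∈ Ico (0 : ℝ) 1 := by simp
    -- the cells to the left and to the right of the edge
    have key : ∀ c c' : ℤ × ℤ, c ∈ R → c' ∉ R →
        (∀ d : ℤ × ℤ, (d = c ∨ d = c') →
          gridPoint δ (x, y) + u * (gridPoint δ w - gridPoint δ (x, y)) ∈ closedCell δ d) →
        (∃ c ∈ R, gridPoint δ (x, y) + u * (gridPoint δ w - gridPoint δ (x, y)) ∈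
          closedCell δ c) ∧
        ∃ c, gridPoint δ (x, y) + u * (gridPoint δ w - gridPoint δ (x, y)) ∈ closedCell δ c ∧
          c ∉ R := fun c c' hc hc' hd => ⟨⟨c, hc, hd c (Or.inl rfl)⟩, c', hd c' (Or.inr rfl), hc'⟩
    rcases h with ⟨rfl, h1, h2⟩ | ⟨rfl, h1, h2⟩ | ⟨rfl, h1, h2⟩ | ⟨rfl, h1, h2⟩ <;>
    · refine key _ _ h1 h2 fun d hd => ?_
      rw [gridPoint_add_mul]
      rcases hd with rfl | rfl <;>
      · refine ⟨⟨?_, ?_⟩, ?_, ?_⟩ <;> refine mul_le_mul_of_nonneg_left ?_ hδ.le <;> push_cast <;>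
          nlinarith [hu.1, hu.2]

/-! ### Summation over the boundary edges -/

section Summation

variable (R) in
/-- The vertices of the cells in `R`. -/
def cellVertices : Finset (ℤ × ℤ) :=
  R ∪ R.image (· + (1, 0)) ∪ R.image (· + (0, 1)) ∪ R.image (· + (1, 1))

theorem BoundaryEdge.mem_cellVertices {v w : ℤ × ℤ} (h : BoundaryEdge R v w) :
    v ∈ cellVertices R := by
  obtain ⟨x, y⟩ := v
  simp only [cellVertices, Finset.mem_union, Finset.mem_image]
  rcases h with ⟨-, h, -⟩ | ⟨-, h, -⟩ | ⟨-, h, -⟩ | ⟨-, h, -⟩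
  · exact Or.inl (Or.inl (Or.inl h))
  · exact Or.inl (Or.inl (Or.inr ⟨_, h, by simp⟩))
  · exact Or.inr ⟨_, h, by simp⟩
  · exact Or.inl (Or.inr ⟨_, h, by simp⟩)

/-- A sum over vertices with a given cell in `R` is a sum over the cells of `R`. -/
theorem sum_shift {B : Finset (ℤ × ℤ)} (s : ℤ × ℤ) (hB : R.image (· + s) ⊆ B)
    (Q : ℤ × ℤ → Prop) [DecidablePred Q] (h : ℤ × ℤ → ℂ) :
    ∑ v ∈ B, (if v - s ∈ R ∧ Q v then h v else 0) =
      ∑ c ∈ R, if Q (c + s) then h (c + s) else 0 := by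
  rw [← Finset.sum_subset hB, Finset.sum_image (by simp)]
  · refine Finset.sum_congr rfl fun c hc => ?_
    simp [hc]
  · intro v _ hv
    refine if_neg fun h' => hv (Finset.mem_image.2 ⟨v - s, h'.1, ?_⟩)
    simp

theorem sum_neighbour (s : ℤ × ℤ) (h : ℤ × ℤ → ℂ) :
    ∑ c ∈ R, (if c - s ∈ R then h c else 0) = ∑ c ∈ R, if c + s ∈ R then h (c + s) else 0 := by
  rw [← Finset.sum_filter, ← Finset.sum_filter]
  refine Finset.sum_nbij' (· - s) (· + s) ?_ ?_ ?_ ?_ ?_ <;> simp +contextual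

/-- The sum of the integrals along the boundaries of the cells of `R` reduces to the sum over the
boundary edges, since each edge between two cells of `R` occurs in both directions. -/
theorem sum_boundaryEdge (hR : NoCheckerboard R) (seg : ℤ × ℤ → ℤ × ℤ → ℂ)
    (hseg : ∀ v w, seg w v = -seg v w) [Fintype {v // ∃ w, BoundaryEdge R v w}]
    (next : {v // ∃ w, BoundaryEdge R v w} → {v // ∃ w, BoundaryEdge R v w})
    (hnext : ∀ v, BoundaryEdge R v.1 (next v).1) :
    ∑ v, seg v.1 (next v).1 = ∑ c ∈ R, (seg c (c + (1, 0)) + seg (c + (1, 0)) (c + (1, 1)) -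
      seg (c + (0, 1)) (c + (1, 1)) - seg c (c + (0, 1))) := by
  classical
  let G : ℤ × ℤ → ℂ := fun v =>
    (if v - (0, 0) ∈ R ∧ v - (0, 1) ∉ R then seg v (v + (1, 0)) else 0) +
    (if v - (1, 0) ∈ R ∧ v ∉ R then seg v (v + (0, 1)) else 0) +
    (if v - (1, 1) ∈ R ∧ v - (1, 0) ∉ R then seg v (v - (1, 0)) else 0) +
    (if v - (0, 1) ∈ R ∧ v - (1, 1) ∉ R then seg v (v - (0, 1)) else 0)
  have hG : ∀ v w, BoundaryEdge R v w → seg v w = G v := by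
    rintro ⟨x, y⟩ w h
    have := hR x y
    simp only [BoundaryEdge] at h
    simp only [G, Prod.mk_sub_mk, Prod.mk_add_mk, sub_zero, add_zero]
    rcases h with ⟨rfl, h1, h2⟩ | ⟨rfl, h1, h2⟩ | ⟨rfl, h1, h2⟩ | ⟨rfl, h1, h2⟩
    · rw [if_pos ⟨h1, h2⟩, if_neg (by grind only), if_neg (by grind only), if_neg (by grind only)]
      ring
    · rw [if_neg (by grind only), if_pos ⟨h1, h2⟩, if_neg (by grind only), if_neg (by grind only)]
      ring
    · rw [if_neg (by grind only), if_neg (by grind only), if_pos ⟨h1, h2⟩, if_neg (by grind only)]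
      ring
    · rw [if_neg (by grind only), if_neg (by grind only), if_neg (by grind only), if_pos ⟨h1, h2⟩]
      ring
  have hG0 : ∀ v, G v ≠ 0 → ∃ w, BoundaryEdge R v w := by
    rintro ⟨x, y⟩ h
    by_contra! hcon
    have e1 := hcon (x + 1, y)
    have e2 := hcon (x, y + 1)
    have e3 := hcon (x - 1, y)
    have e4 := hcon (x, y - 1)
    simp only [BoundaryEdge, true_and, not_or] at e1 e2 e3 e4
    apply h
    simp only [G, Prod.mk_sub_mk, Prod.mk_add_mk, sub_zero, add_zero]
    rw [if_neg e1.1, if_neg e2.2.1, if_neg e3.2.2.1, if_neg e4.2.2.2]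
    ring
  have hsum : ∑ v : {v // ∃ w, BoundaryEdge R v w}, seg v.1 (next v).1 =
      ∑ v ∈ cellVertices R, G v := by
    rw [Finset.sum_congr rfl fun v _ => hG v.1 (next v).1 (hnext v),
      ← Finset.sum_filter_of_ne (p := fun v => ∃ w, BoundaryEdge R v w) fun v _ => hG0 v]
    refine (Finset.sum_subtype _ (fun v => ?_) G).symm
    rw [Finset.mem_filter]
    exact ⟨fun h => h.2, fun h => ⟨h.choose_spec.mem_cellVertices, h⟩⟩
  have hsub : ∀ s ∈ ({(0, 0), (1, 0), (0, 1), (1, 1)} : Set (ℤ × ℤ)),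
      R.image (· + s) ⊆ cellVertices R := by
    rintro s (rfl | rfl | rfl | rfl) v hv
    · rw [← Prod.zero_eq_mk] at hv
      simp only [add_zero, Finset.image_id'] at hv
      simp [cellVertices, hv]
    all_goals
      simp only [cellVertices, Finset.mem_union]
      tauto
  have e1 := sum_neighbour (R := R) (0, 1) fun c => seg c (c + (1, 0))
  have e2 := sum_neighbour (R := R) (1, 0) fun c => seg c (c + (0, 1))
  simp only [G, Finset.sum_add_distrib] at hsum
  rw [sum_shift (0, 0) (hsub _ (by simp)) (fun v => v - (0, 1) ∉ R) fun v => seg v (v + (1, 0)),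
    sum_shift (1, 0) (hsub _ (by simp)) (fun v => v ∉ R) fun v => seg v (v + (0, 1)),
    sum_shift (1, 1) (hsub _ (by simp)) (fun v => v - (1, 0) ∉ R) fun v => seg v (v - (1, 0)),
    sum_shift (0, 1) (hsub _ (by simp)) (fun v => v - (1, 1) ∉ R) fun v => seg v (v - (0, 1))]
    at hsum
  rw [hsum, ← Finset.sum_add_distrib, ← Finset.sum_add_distrib, ← Finset.sum_add_distrib,
    ← sub_eq_zero, ← Finset.sum_sub_distrib]
  rw [← sub_eq_zero, ← Finset.sum_sub_distrib] at e1 e2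
  calc _ = ∑ c ∈ R, (-((if c - (0, 1) ∈ R then seg c (c + (1, 0)) else 0) -
        if c + (0, 1) ∈ R then seg (c + (0, 1)) (c + (0, 1) + (1, 0)) else 0) +
        ((if c - (1, 0) ∈ R then seg c (c + (0, 1)) else 0) -
        if c + (1, 0) ∈ R then seg (c + (1, 0)) (c + (1, 0) + (0, 1)) else 0)) := by
        refine Finset.sum_congr rfl ?_
        rintro ⟨x, y⟩ -
        simp only [Prod.mk_sub_mk, Prod.mk_add_mk, sub_zero, add_zero, add_sub_cancel_right,
          ite_not]
        rw [hseg (x, y + 1) (x + 1, y + 1), hseg (x, y) (x, y + 1)]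
        have e3 : y + 1 - 1 = y := by ring
        have e4 : x + 1 - 1 = x := by ring
        split_ifs <;> ring
    _ = 0 := by rw [Finset.sum_add_distrib, Finset.sum_neg_distrib, e1, e2, neg_zero, add_zero]

end Summation

/-! ### The Cauchy contour of a grid region -/

theorem rectangleIntegral_cell (c : ℤ × ℤ) (f : ℂ → ℂ) :
    rectangleIntegral (δ * c.1) (δ * (c.1 + 1)) (δ * c.2) (δ * (c.2 + 1)) f =
      segmentIntegral (gridPoint δ c) (gridPoint δ (c + (1, 0))) f +
      segmentIntegral (gridPoint δ (c + (1, 0))) (gridPoint δ (c + (1, 1))) f -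
      segmentIntegral (gridPoint δ (c + (0, 1))) (gridPoint δ (c + (1, 1))) f -
      segmentIntegral (gridPoint δ c) (gridPoint δ (c + (0, 1))) f := by
  simp [rectangleIntegral, gridPoint]

theorem RectifiableJordanCurve.continuousOn_index (γ : RectifiableJordanCurve) :
    ContinuousOn γ.index γ.imageᶜ := by
  have hne : ∀ t ∈ γ.imageᶜ, ∀ z ∈ γ.image, z - t ≠ 0 := fun t ht z hz h => ht (by
    rwa [← sub_eq_zero.1 h])
  intro w hw
  refine ContinuousAt.continuousWithinAt (continuousAt_const.mul (HasDerivAt.continuousAt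
    (γ.hasDerivAt_integral γ.isCompact_image.isClosed.isOpen_compl
    (G := fun w z => (z - w)⁻¹) (G' := fun w z => ((z - w)⁻¹) ^ 2)
    (fun t ht => ContinuousOn.inv₀ (by fun_prop) (hne t ht)) ?_ ?_ hw)))
  · refine ContinuousOn.pow (ContinuousOn.inv₀ (by fun_prop) ?_) _
    rintro ⟨t, z⟩ ⟨ht, hz⟩
    exact hne t ht z hz
  · intro t ht z hz
    refine (((hasDerivAt_id t).const_sub z).inv (hne t ht z hz)).congr_deriv ?_
    simp [inv_pow]

/-- The boundary edges, run through in their direction, make up the curves of a Cauchy contour. -/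
theorem exists_cauchyContour_inner_eq (hδ : 0 < δ) (hR : NoCheckerboard R) :
    ∃ Γ : CauchyContour, Γ.inner = gridInterior δ R := by
  classical
  have hfin : Finite {v // ∃ w, BoundaryEdge R v w} :=
    ((cellVertices R).finite_toSet.subset fun v (h : ∃ w, BoundaryEdge R v w) =>
      h.choose_spec.mem_cellVertices).to_subtype
  have := Fintype.ofFinite {v // ∃ w, BoundaryEdge R v w}
  let next : {v // ∃ w, BoundaryEdge R v w} → {v // ∃ w, BoundaryEdge R v w} := fun v =>
    ⟨v.2.choose, v.2.choose_spec.exists_next⟩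
  have hnext : ∀ v, BoundaryEdge R v.1 (next v).1 := fun v => v.2.choose_spec
  have hinj : Function.Injective next := fun v v' h => Subtype.ext
    ((hnext v).left_unique hR (h ▸ hnext v'))
  let σ := Equiv.ofBijective next (Finite.injective_iff_bijective.1 hinj)
  obtain ⟨N, curve, himage, hdisj, hint⟩ := exists_polygons_of_perm σ
    (fun v => gridPoint δ v.1) (by
      intro v w u hu u' hu' h
      obtain ⟨h1, h2⟩ := (hnext v).eq_of_point_eq hδ (hnext w) hu hu' h
      exact ⟨Subtype.ext h1, h2⟩)
  have hfront : ⋃ k, (curve k).image = gridRegion δ R \ gridInterior δ R := by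
    rw [himage]
    ext p
    rw [mem_region_diff_interior_iff hδ]
    constructor
    · rintro ⟨v, u, hu, rfl⟩
      exact ⟨v.1, _, hnext v, u, hu, rfl⟩
    · rintro ⟨v, w, h, u, hu, rfl⟩
      exact ⟨⟨v, w, h⟩, u, hu, congrArg
        (fun w' => gridPoint δ v + u * (gridPoint δ w' - gridPoint δ v))
        (h.right_unique hR (hnext ⟨v, w, h⟩))⟩
  -- away from the grid lines the winding number is counted cell by cell
  have hindex : ∀ c₀, ∀ w ∈ openCell δ c₀,
      ∑ k, (curve k).index w = if c₀ ∈ R then 1 else 0 := by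
    intro c₀ w hw
    have hw' : w ∉ ⋃ k, (curve k).image := by
      rw [hfront]
      rintro ⟨h1, h2⟩
      obtain ⟨c, hc, hwc⟩ := mem_gridRegion_iff.1 h1
      rw [eq_of_mem_openCell hδ hw hwc] at hc
      exact h2 (openCell_subset_gridInterior hδ hc hw)
    have hcont : ContinuousOn (fun z => (z - w)⁻¹) (⋃ k, (curve k).image) := by
      simpa using CauchyContour.continuousOn_inv_sub_pow hw' 1
    simp only [RectifiableJordanCurve.index, ← Finset.mul_sum]
    rw [hint _ hcont, sum_boundaryEdge hR
      (fun v w' => segmentIntegral (gridPoint δ v) (gridPoint δ w') fun z => (z - w)⁻¹)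
      (fun v w' => segmentIntegral_symm _ _ _) σ hnext]
    simp only [← rectangleIntegral_cell]
    have hcell : ∀ c ∈ R, rectangleIntegral (δ * c.1) (δ * (c.1 + 1)) (δ * c.2) (δ * (c.2 + 1))
        (fun z => (z - w)⁻¹) = if c = c₀ then 2 * Real.pi * Complex.I else 0 := by
      intro c _
      split_ifs with h
      · rw [h]
        exact rectangleIntegral_inv_sub_of_mem hw.1 hw.2
      · refine rectangleIntegral_inv_sub_of_notMem ?_ ?_ fun h' => h (eq_of_mem_openCell hδ hw h')
        all_goals exact mul_le_mul_of_nonneg_left (by linarith) hδ.le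
    rw [Finset.sum_congr rfl hcell, Finset.sum_ite_eq']
    split_ifs
    · exact inv_mul_cancel₀ Complex.two_pi_I_ne_zero
    · exact mul_zero _
  have hcontInd : ContinuousOn (fun w => ∑ k, (curve k).index w) (⋃ k, (curve k).image)ᶜ :=
    continuousOn_finsetSum _ fun k _ => (curve k).continuousOn_index.mono
      (compl_subset_compl.2 (subset_iUnion (fun k => (curve k).image) k))
  have hdense := dense_iUnion_openCell hδ
  refine ⟨{ inner := gridInterior δ R
            numCurves := N
            curve := curve
            isOpen_inner := isOpen_gridInterior hδ
            isBounded_inner := isCompact_gridRegion.isBounded.subset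
              (gridInterior_subset_gridRegion hδ)
            finite_components := finite_components_gridInterior hδ
            disjoint_closures := fun C C' hC hC' hne =>
              disjoint_closure_components hδ hR hC hC' hne
            frontier_inner := ?_
            disjoint_curves := hdisj
            index_inner := ?_
            index_outer := ?_ }, rfl⟩
  · rw [frontier, closure_gridInterior hδ, (isOpen_gridInterior hδ).interior_eq, hfront]
  · have hsub : gridInterior δ R ⊆ (⋃ k, (curve k).image)ᶜ := by
      rw [hfront]
      exact fun w hw h => h.2 hw
    refine EqOn.of_subset_closure (s := gridInterior δ R ∩ ⋃ c, openCell δ c) ?_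
      (hcontInd.mono hsub) continuousOn_const inter_subset_left
      (hdense.open_subset_closure_inter (isOpen_gridInterior hδ))
    rintro w ⟨hw, hw'⟩
    obtain ⟨c, hc⟩ := mem_iUnion.1 hw'
    change ∑ k, (curve k).index w = 1
    rw [hindex c w hc, if_pos (hw c (openCell_subset_closedCell c hc))]
  · rw [closure_gridInterior hδ]
    have hsub : (gridRegion δ R)ᶜ ⊆ (⋃ k, (curve k).image)ᶜ := by
      rw [hfront]
      exact fun w hw h => hw h.1
    refine EqOn.of_subset_closure (s := (gridRegion δ R)ᶜ ∩ ⋃ c, openCell δ c) ?_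
      (hcontInd.mono hsub) continuousOn_const inter_subset_left
      (hdense.open_subset_closure_inter isCompact_gridRegion.isClosed.isOpen_compl)
    rintro w ⟨hw, hw'⟩
    obtain ⟨c, hc⟩ := mem_iUnion.1 hw'
    change ∑ k, (curve k).index w = 0
    rw [hindex c w hc, if_neg fun hcR => hw (mem_gridRegion_iff.2
      ⟨c, hcR, openCell_subset_closedCell c hc⟩)]

/-! ### Separation by a Cauchy contour -/

/-- Bricks are the pairs of neighbouring cells of a row in which the left one has an even sum of
coordinates; `brick c` numbers the brick of the cell `c`. -/
def brick (c : ℤ × ℤ) : ℤ × ℤ := ((c.1 + c.2) / 2, c.2)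

/-- In a wall of bricks at most three bricks meet at a vertex. Hence a set of cells that is composed
of bricks has no checkerboard. -/
theorem noCheckerboard_of_brick (h : ∀ c c', brick c = brick c' → c ∈ R → c' ∈ R) :
    NoCheckerboard R := by
  intro x y
  rcases Int.even_or_odd (x + y) with ⟨k, hk⟩ | ⟨k, hk⟩
  · have e : brick (x, y - 1) = brick (x - 1, y - 1) := by
      simp only [brick, Prod.mk.injEq, and_true]
      omega
    exact ⟨fun _ h' => Or.inr (h _ _ e.symm h'), fun _ h' => Or.inr (h _ _ e h')⟩
  · have e : brick (x, y) = brick (x - 1, y) := by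
      simp only [brick, Prod.mk.injEq, and_true]
      omega
    exact ⟨fun h' _ => Or.inl (h _ _ e h'), fun h' _ => Or.inl (h _ _ e.symm h')⟩

/-- Disjoint sets, one compact and one closed, are separated by a Cauchy contour: the oriented
boundary of the union of the bricks, of a sufficiently fine wall, that meet the compact set. -/
theorem exists_cauchyContour {K L : Set ℂ} (hK : IsCompact K) (hL : IsClosed L)
    (hKL : Disjoint K L) : ∃ Γ : CauchyContour, K ⊆ Γ.inner ∧ L ⊆ Γ.outer := by
  obtain ⟨r, hr, hdist⟩ := Metric.exists_pos_forall_lt_edist hK hL hKL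
  -- two points of the same brick have distance at most `3 * δ`
  obtain ⟨δ, hδ, hδr⟩ : ∃ δ : ℝ, 0 < δ ∧ 3 * δ = r := ⟨r / 3, div_pos (by exact_mod_cast hr)
    (by norm_num), by ring⟩
  have hfin : {c : ℤ × ℤ | ∃ c', brick c = brick c' ∧ (K ∩ closedCell δ c').Nonempty}.Finite := by
    obtain ⟨ρ, hρ⟩ := hK.isBounded.exists_norm_le
    obtain ⟨m, hm⟩ := exists_nat_ge (ρ / δ)
    rw [div_le_iff₀ hδ] at hm
    refine ((finite_Icc (-(m : ℤ) - 2) (m + 2)).prod (finite_Icc (-(m : ℤ) - 2) (m + 2))).subset ?_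
    rintro ⟨x, y⟩ ⟨⟨x', y'⟩, hc, p, hpK, hp⟩
    have hbound : ∀ (n : ℤ) (s : ℝ), |s| ≤ ρ → s ∈ Icc (δ * n) (δ * (n + 1)) →
        -(m : ℤ) - 1 ≤ n ∧ n ≤ m := by
      intro n s hs hn
      have h1 := abs_le.1 hs
      have h2 : (n : ℝ) ≤ m := le_of_mul_le_mul_left (by linarith [hn.1]) hδ
      have h3 : -(m : ℝ) ≤ n + 1 := le_of_mul_le_mul_left (by linarith [hn.2]) hδ
      have h4 : -(m : ℤ) ≤ n + 1 := by exact_mod_cast h3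
      exact ⟨by omega, by exact_mod_cast h2⟩
    have hx := hbound x' p.re ((Complex.abs_re_le_norm p).trans (hρ p hpK)) hp.1
    have hy := hbound y' p.im ((Complex.abs_im_le_norm p).trans (hρ p hpK)) hp.2
    simp only [brick, Prod.mk.injEq] at hc
    simp only [mem_prod, mem_Icc]
    omega
  set R := hfin.toFinset
  have hmem : ∀ c, c ∈ R ↔ ∃ c', brick c = brick c' ∧ (K ∩ closedCell δ c').Nonempty := fun c =>
    hfin.mem_toFinset
  obtain ⟨Γ, hΓ⟩ := exists_cauchyContour_inner_eq (R := R) hδ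
    (noCheckerboard_of_brick fun c c' h hc => by
      rw [hmem] at hc ⊢
      rwa [← h])
  refine ⟨Γ, ?_, ?_⟩
  · rw [hΓ]
    exact fun p hp c hc => (hmem c).2 ⟨c, rfl, p, hp, hc⟩
  · intro p hp
    rw [CauchyContour.outer, hΓ, closure_gridInterior hδ, mem_compl_iff, mem_gridRegion_iff]
    rintro ⟨⟨x, y⟩, hc, hpc⟩
    obtain ⟨⟨x', y'⟩, hb, q, hqK, hq⟩ := (hmem _).1 hc
    have h1 := hdist q hqK p hp
    rw [edist_dist, ← ENNReal.ofReal_coe_nnreal,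
      ENNReal.ofReal_lt_ofReal_iff_of_nonneg r.coe_nonneg, dist_eq_norm] at h1
    refine absurd h1 (not_lt.2 ((Complex.norm_le_abs_re_add_abs_im _).trans ?_))
    simp only [brick, Prod.mk.injEq] at hb
    obtain ⟨hb1, rfl⟩ := hb
    have hxx : x' ≤ x + 1 ∧ x ≤ x' + 1 := by omega
    have hx1 : (x' : ℝ) ≤ x + 1 := by exact_mod_cast hxx.1
    have hx2 : (x : ℝ) ≤ x' + 1 := by exact_mod_cast hxx.2
    have hx1' := mul_le_mul_of_nonneg_left hx1 hδ.le
    have hx2' := mul_le_mul_of_nonneg_left hx2 hδ.le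
    have e1 : |(q - p).re| ≤ 2 * δ := by
      rw [Complex.sub_re, abs_le]
      have := hpc.1.1
      have := hpc.1.2
      have := hq.1.1
      have := hq.1.2
      constructor <;> linarith
    have e2 : |(q - p).im| ≤ δ := by
      rw [Complex.sub_im, abs_le]
      have := hpc.2.1
      have := hpc.2.2
      have := hq.2.1
      have := hq.2.2
      constructor <;> linarith
    linarith

end Grid

/-! ### Components of a space meeting a finite set -/

/-- If every nonempty clopen set meets a fixed finite set, then there are only finitely many
connected components, so that each of them is clopen. -/
theorem isClopen_connectedComponent_of_finite {X : Type*} [TopologicalSpace X] {F : Set X}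
    (hF : F.Finite) (h : ∀ U : Set X, IsClopen U → U.Nonempty → (U ∩ F).Nonempty) (x : X) :
    IsClopen (connectedComponent x) := by
  have hfin : Finite (ConnectedComponents X) := by
    by_contra hinf
    rw [not_finite_iff_infinite] at hinf
    obtain ⟨U, hU, hne, hdisj, -⟩ :=
      ConnectedComponents.exists_fun_isClopen_of_infinite X (F.ncard + 1) (Nat.succ_pos _)
    choose f hf using fun i => h (U i) (hU i) (hne i)
    have hinj : Function.Injective f := fun i j hij => by
      by_contra hne
      exact disjoint_left.1 (hdisj hne) (hf i).1 (hij ▸ (hf j).1)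
    have := hF.to_subtype
    have hcard := Nat.card_le_card_of_injective (fun i => (⟨f i, (hf i).2⟩ : F))
      fun i j hij => hinj (congrArg Subtype.val hij)
    rw [Nat.card_eq_fintype_card, Fintype.card_fin, Nat.card_coe_set_eq] at hcard
    omega
  refine ⟨isClosed_connectedComponent, ?_⟩
  have hcompl : (connectedComponent x)ᶜ =
      ⋃ c ∈ ({(x : ConnectedComponents X)}ᶜ : Set (ConnectedComponents X)),
        ((↑) : X → ConnectedComponents X) ⁻¹' {c} := by
    ext y
    rw [← connectedComponents_preimage_singleton]
    simp
  rw [← isClosed_compl_iff, hcompl]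
  refine (toFinite _).isClosed_biUnion fun c _ => ?_
  obtain ⟨y, rfl⟩ := ConnectedComponents.surjective_coe c
  rw [connectedComponents_preimage_singleton]
  exact isClosed_connectedComponent

/-! ### The pseudospectrum -/

variable {n : ℕ} {A E : Matrix (Fin n) (Fin n) ℂ} {ε : ℝ}

theorem spectrum_add_subset_pseudospectrum (hE : ‖E‖ ≤ ε) :
    spectrum ℂ (A + E) ⊆ pseudospectrum A ε := fun _ hz => ⟨E, hE, hz⟩

theorem norm_smul_le_of_mem_closedBall (hE : ‖E‖ ≤ ε) {t : ℂ}
    (ht : t ∈ Metric.closedBall (0 : ℂ) 1) : ‖t • E‖ ≤ ε := by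
  rw [norm_smul]
  exact (mul_le_of_le_one_left (norm_nonneg E) (mem_closedBall_zero_iff.1 ht)).trans hE

theorem isCompact_pseudospectrum (A : Matrix (Fin n) (Fin n) ℂ) (ε : ℝ) :
    IsCompact (pseudospectrum A ε) := by
  have : ProperSpace (Matrix (Fin n) (Fin n) ℂ) := FiniteDimensional.proper ℂ _
  set r := (‖A‖ + ε) * ‖(1 : Matrix (Fin n) (Fin n) ℂ)‖
  have hclosed : IsClosed {q : Matrix (Fin n) (Fin n) ℂ × ℂ | q.2 ∈ spectrum ℂ (A + q.1)} := by
    rw [← isOpen_compl_iff]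
    have : {q : Matrix (Fin n) (Fin n) ℂ × ℂ | q.2 ∈ spectrum ℂ (A + q.1)}ᶜ =
        {q | IsUnit (A + q.1 - q.2 • (1 : Matrix (Fin n) (Fin n) ℂ))} := by
      ext q
      exact notMem_spectrum_iff
    rw [this]
    exact Units.isOpen.preimage (((continuous_const.add continuous_fst).sub
      (continuous_snd.smul continuous_const)) : Continuous
        fun q : Matrix (Fin n) (Fin n) ℂ × ℂ => A + q.1 - q.2 • (1 : Matrix (Fin n) (Fin n) ℂ))
  have hcomp := (((isCompact_closedBall (0 : Matrix (Fin n) (Fin n) ℂ) ε).prod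
    (isCompact_closedBall (0 : ℂ) r)).inter_right hclosed).image continuous_snd
  convert hcomp
  ext z
  constructor
  · rintro ⟨E, hE, hz⟩
    refine ⟨(E, z), ⟨⟨mem_closedBall_zero_iff.2 hE, mem_closedBall_zero_iff.2 ?_⟩, hz⟩, rfl⟩
    refine (spectrum.norm_le_norm_mul_of_mem hz).trans
      (mul_le_mul_of_nonneg_right ?_ (norm_nonneg _))
    exact (norm_add_le _ _).trans (by gcongr)
  · rintro ⟨⟨E, w⟩, ⟨⟨hE, -⟩, hz⟩, rfl⟩
    exact ⟨E, mem_closedBall_zero_iff.1 hE, hz⟩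

theorem mem_roots_charpoly_iff {M : Matrix (Fin n) (Fin n) ℂ} {z : ℂ} :
    z ∈ M.charpoly.roots ↔ z ∈ spectrum ℂ M := by
  rw [Polynomial.mem_roots M.charpoly_monic.ne_zero, Matrix.mem_spectrum_iff_isRoot_charpoly]

theorem eigenvalueCount_congr {M : Matrix (Fin n) (Fin n) ℂ} {S T : Set ℂ}
    (h : spectrum ℂ M ∩ S = spectrum ℂ M ∩ T) : eigenvalueCount M S = eigenvalueCount M T := by
  classical
  refine Multiset.countP_congr rfl fun z hz => ?_
  rw [mem_roots_charpoly_iff] at hz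
  simpa [hz] using Set.ext_iff.1 h z

theorem eigenvalueCount_pos_iff {M : Matrix (Fin n) (Fin n) ℂ} {S : Set ℂ} :
    0 < eigenvalueCount M S ↔ (spectrum ℂ M ∩ S).Nonempty := by
  classical
  rw [eigenvalueCount, Multiset.countP_pos]
  simp only [mem_roots_charpoly_iff]
  rfl

section Separated

variable {K L : Set ℂ} {Γ : CauchyContour}

/-- A contour that separates two parts of the pseudospectrum avoids the spectra of all admissible
perturbations. -/
theorem notMem_spectrum_of_mem_image (hKL : pseudospectrum A ε ⊆ K ∪ L) (hK : K ⊆ Γ.inner)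
    (hL : L ⊆ Γ.outer) (hE : ‖E‖ ≤ ε) : ∀ z ∈ Γ.image, z ∉ spectrum ℂ (A + E) := by
  intro z hz hzE
  exact Γ.mem_inner_or_mem_outer_iff.1
    ((hKL (spectrum_add_subset_pseudospectrum hE hzE)).imp (@hK z) (@hL z)) hz

theorem spectrum_inter_inner (hKL : pseudospectrum A ε ⊆ K ∪ L) (hK : K ⊆ Γ.inner)
    (hL : L ⊆ Γ.outer) (hE : ‖E‖ ≤ ε) : spectrum ℂ (A + E) ∩ Γ.inner = spectrum ℂ (A + E) ∩ K := by
  ext z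
  refine ⟨fun ⟨hz, hi⟩ => ⟨hz, ?_⟩, fun ⟨hz, hi⟩ => ⟨hz, hK hi⟩⟩
  exact (hKL (spectrum_add_subset_pseudospectrum hE hz)).resolve_right fun h =>
    disjoint_left.1 Γ.disjoint_inner_outer hi (hL h)

theorem spectrum_inter_outer (hKL : pseudospectrum A ε ⊆ K ∪ L) (hK : K ⊆ Γ.inner)
    (hL : L ⊆ Γ.outer) (hE : ‖E‖ ≤ ε) : spectrum ℂ (A + E) ∩ Γ.outer = spectrum ℂ (A + E) ∩ L := by
  ext z
  refine ⟨fun ⟨hz, hi⟩ => ⟨hz, ?_⟩, fun ⟨hz, hi⟩ => ⟨hz, hL hi⟩⟩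
  exact (hKL (spectrum_add_subset_pseudospectrum hE hz)).resolve_left fun h =>
    disjoint_left.1 Γ.disjoint_inner_outer (hK h) hi

theorem spectrum_diff_inner (hKL : pseudospectrum A ε ⊆ K ∪ L) (hK : K ⊆ Γ.inner)
    (hL : L ⊆ Γ.outer) (hE : ‖E‖ ≤ ε) :
    spectrum ℂ (A + E) \ Γ.inner = spectrum ℂ (A + E) ∩ Γ.outer := by
  ext z
  refine ⟨fun ⟨hz, hi⟩ => ⟨hz, ?_⟩, fun ⟨hz, hi⟩ =>
    ⟨hz, fun h => disjoint_left.1 Γ.disjoint_inner_outer h hi⟩⟩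
  exact (Γ.mem_inner_or_mem_outer_iff.2 fun h =>
    notMem_spectrum_of_mem_image hKL hK hL hE z h hz).resolve_left hi

theorem eigenvalueCount_inner_eq_of_separated (hKL : pseudospectrum A ε ⊆ K ∪ L)
    (hK : K ⊆ Γ.inner) (hL : L ⊆ Γ.outer) (hE : ‖E‖ ≤ ε) {t : ℂ}
    (ht : t ∈ Metric.closedBall (0 : ℂ) 1) :
    eigenvalueCount (A + t • E) Γ.inner = eigenvalueCount A Γ.inner := by
  have := eigenvalueCount_inner_eq Γ (A := A) (E := E)
    (convex_closedBall (0 : ℂ) 1).isPreconnected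
    (fun t ht => notMem_spectrum_of_mem_image hKL hK hL (norm_smul_le_of_mem_closedBall hE ht))
    ht (Metric.mem_closedBall_self zero_le_one)
  rwa [zero_smul, add_zero] at this

/-- Separated parts of the pseudospectrum exchange no eigenvalues. -/
theorem eigenvalueCount_eq_of_separated (hKL : pseudospectrum A ε ⊆ K ∪ L) (hK : IsCompact K)
    (hL : IsCompact L) (hdisj : Disjoint K L) (hε : 0 ≤ ε) (hE : ‖E‖ ≤ ε) {t : ℂ}
    (ht : t ∈ Metric.closedBall (0 : ℂ) 1) :
    eigenvalueCount (A + t • E) K = eigenvalueCount A K := by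
  obtain ⟨Γ, hKΓ, hLΓ⟩ := exists_cauchyContour hK hL.isClosed hdisj
  have h0 := spectrum_inter_inner (E := 0) hKL hKΓ hLΓ (by simpa using hε)
  rw [add_zero] at h0
  rw [← eigenvalueCount_congr (spectrum_inter_inner hKL hKΓ hLΓ
    (norm_smul_le_of_mem_closedBall hE ht)), ← eigenvalueCount_congr h0]
  exact eigenvalueCount_inner_eq_of_separated hKL hKΓ hLΓ hE ht

end Separated

/-- Every nonempty clopen part of the pseudospectrum of `A` contains an eigenvalue of `A`. Hence
the components of the pseudospectrum are clopen in it. -/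
theorem isClopen_connectedComponent_pseudospectrum (hε : 0 ≤ ε) (x : pseudospectrum A ε) :
    IsClopen (connectedComponent x) := by
  have hcomp : CompactSpace (pseudospectrum A ε) :=
    isCompact_iff_compactSpace.1 (isCompact_pseudospectrum A ε)
  refine isClopen_connectedComponent_of_finite (F := Subtype.val ⁻¹' spectrum ℂ A) ?_ ?_ x
  · refine Finite.preimage Subtype.val_injective.injOn ?_
    exact A.charpoly.roots.toFinset.finite_toSet.subset fun z hz =>
      Multiset.mem_toFinset.2 (mem_roots_charpoly_iff.2 hz)
  · rintro U hU ⟨⟨z, E, hE, hz⟩, hzU⟩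
    have hcov : pseudospectrum A ε ⊆ Subtype.val '' U ∪ Subtype.val '' Uᶜ := by
      rw [← image_union, union_compl_self, image_univ, Subtype.range_coe]
    have hcount := eigenvalueCount_eq_of_separated hcov
      (hU.1.isCompact.image continuous_subtype_val)
      (hU.compl.1.isCompact.image continuous_subtype_val)
      ((disjoint_image_iff Subtype.val_injective).2 disjoint_compl_right) hε hE
      (t := 1) (by simp)
    rw [one_smul] at hcount
    have hpos : 0 < eigenvalueCount (A + E) (Subtype.val '' U) :=
      eigenvalueCount_pos_iff.2 ⟨z, hz, _, hzU, rfl⟩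
    rw [hcount, eigenvalueCount_pos_iff] at hpos
    obtain ⟨w, hw, u, hu, rfl⟩ := hpos
    exact ⟨u, hu, hw⟩

theorem isCompact_iUnion_components (hε : 0 ≤ ε) {m : ℕ} {component : Fin m → Set ℂ}
    (hcomponent : ∀ j, IsComponent (component j) (pseudospectrum A ε)) :
    IsCompact (⋃ j, component j) ∧ IsCompact (pseudospectrum A ε \ ⋃ j, component j) := by
  have hcomp : CompactSpace (pseudospectrum A ε) :=
    isCompact_iff_compactSpace.1 (isCompact_pseudospectrum A ε)
  choose z hz hzc using hcomponent
  set U : Set (pseudospectrum A ε) := ⋃ j, connectedComponent ⟨z j, hz j⟩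
  have hU : IsClopen U := isClopen_iUnion_of_finite fun j =>
    isClopen_connectedComponent_pseudospectrum hε _
  have himg : ⋃ j, component j = Subtype.val '' U := by
    simp only [U, image_iUnion, hzc, connectedComponentIn_eq_image (hz _)]
  have hdiff : pseudospectrum A ε \ ⋃ j, component j = Subtype.val '' Uᶜ := by
    rw [himg, image_compl_eq_range_sdiff_image Subtype.val_injective, Subtype.range_coe]
  rw [hdiff, himg]
  exact ⟨hU.1.isCompact.image continuous_subtype_val,
    hU.compl.1.isCompact.image continuous_subtype_val⟩

end SpectralPerturbation

open SpectralPerturbation in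
theorem mainTheorem6 (n : ℕ) (A : Matrix (Fin n) (Fin n) ℂ) (ε : ℝ) (hε : 0 < ε)
    (m : ℕ) (component : Fin m → Set ℂ)
    (hcomponent : ∀ j, SpectralPerturbation.IsComponent (component j)
      (SpectralPerturbation.pseudospectrum A ε))
    (Δ Δe : Set ℂ) (hΔ : Δ = ⋃ j, component j)
    (hΔe : Δe = SpectralPerturbation.pseudospectrum A ε \ Δ) :
    (IsCompact Δ ∧ IsCompact Δe ∧ Disjoint Δ Δe ∧
      SpectralPerturbation.pseudospectrum A ε = Δ ∪ Δe) ∧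
    (∃ Γ : SpectralPerturbation.CauchyContour, Δ ⊆ Γ.inner ∧ Δe ⊆ Γ.outer) ∧
    (∀ Γ : SpectralPerturbation.CauchyContour, Δ ⊆ Γ.inner → Δe ⊆ Γ.outer →
      ∀ E : Matrix (Fin n) (Fin n) ℂ, ‖E‖ = ε →
        (∀ t ∈ Metric.closedBall (0 : ℂ) 1, Γ.image ⊆ resolventSet ℂ (A + t • E)) ∧
        AnalyticOnNhd ℂ (fun t : ℂ => SpectralPerturbation.spectralProjection Γ (A + t • E))
          (Metric.closedBall (0 : ℂ) 1) ∧
        ∀ t ∈ Metric.closedBall (0 : ℂ) 1,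
          IsIdempotentElem (SpectralPerturbation.spectralProjection Γ (A + t • E)) ∧
          Commute (SpectralPerturbation.spectralProjection Γ (A + t • E)) (A + t • E) ∧
          (SpectralPerturbation.spectralProjection Γ (A + t • E)).rank =
            (SpectralPerturbation.spectralProjection Γ A).rank ∧
          ∃ (hY : ∀ x ∈ LinearMap.range
                (Matrix.toLin' (SpectralPerturbation.spectralProjection Γ (A + t • E))),
              Matrix.toLin' (A + t • E) x ∈ LinearMap.range
                (Matrix.toLin' (SpectralPerturbation.spectralProjection Γ (A + t • E))))
            (hZ : ∀ x ∈ LinearMap.ker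
                (Matrix.toLin' (SpectralPerturbation.spectralProjection Γ (A + t • E))),
              Matrix.toLin' (A + t • E) x ∈ LinearMap.ker
                (Matrix.toLin' (SpectralPerturbation.spectralProjection Γ (A + t • E)))),
            spectrum ℂ (A + t • E) =
              spectrum ℂ ((Matrix.toLin' (A + t • E)).restrict hY) ∪
                spectrum ℂ ((Matrix.toLin' (A + t • E)).restrict hZ) ∧
            spectrum ℂ ((Matrix.toLin' (A + t • E)).restrict hY) =
              spectrum ℂ (A + t • E) ∩ Γ.inner ∧
            spectrum ℂ (A + t • E) ∩ Γ.inner ⊆ Δ ∧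
            spectrum ℂ ((Matrix.toLin' (A + t • E)).restrict hZ) =
              spectrum ℂ (A + t • E) ∩ Γ.outer ∧
            spectrum ℂ (A + t • E) ∩ Γ.outer ⊆ Δe) ∧
    (∀ E : Matrix (Fin n) (Fin n) ℂ, ‖E‖ = ε →
      (∀ t ∈ Metric.closedBall (0 : ℂ) 1,
        SpectralPerturbation.eigenvalueCount (A + t • E) Δ =
          SpectralPerturbation.eigenvalueCount A Δ) ∧
      (∀ S ⊆ Metric.closedBall (0 : ℂ) 1, IsConnected S → (0 : ℂ) ∈ S →
        ∀ path : ℂ → ℂ, ContinuousOn path S → (∀ t ∈ S, path t ∈ spectrum ℂ (A + t • E)) →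
          (path 0 ∈ Δ → ∀ t ∈ S, path t ∈ Δ) ∧
          (path 0 ∈ Δe → ∀ t ∈ S, path t ∈ Δe))) := by
  obtain ⟨hc, hce⟩ := isCompact_iUnion_components hε.le hcomponent
  rw [← hΔ] at hc hce
  rw [← hΔe] at hce
  have hdisj : Disjoint Δ Δe := hΔe ▸ Set.disjoint_sdiff_right
  have hsub : Δ ⊆ pseudospectrum A ε := by
    rw [hΔ]
    refine Set.iUnion_subset fun j => ?_
    obtain ⟨z, -, hz⟩ := hcomponent j
    exact hz ▸ connectedComponentIn_subset _ _
  have hunion : pseudospectrum A ε = Δ ∪ Δe := by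
    rw [hΔe, Set.union_sdiff_cancel hsub]
  refine ⟨⟨hc, hce, hdisj, hunion⟩, exists_cauchyContour hc hce.isClosed hdisj, ?_, ?_⟩
  · intro Γ hΓ hΓe E hE
    have hnorm : ∀ t ∈ Metric.closedBall (0 : ℂ) 1, ‖t • E‖ ≤ ε := fun t ht =>
      norm_smul_le_of_mem_closedBall hE.le ht
    have hres : ∀ t ∈ Metric.closedBall (0 : ℂ) 1, ∀ z ∈ Γ.image, z ∉ spectrum ℂ (A + t • E) :=
      fun t ht => notMem_spectrum_of_mem_image hunion.subset hΓ hΓe (hnorm t ht)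
    refine ⟨fun t ht z hz => not_not.1 (hres t ht z hz),
      fun t ht => analyticAt_spectralProjection Γ (hres t ht), fun t ht => ?_⟩
    have hsel := selectsEigenspaces_spectralProjection Γ (hres t ht)
    have hres0 := hres 0 (Metric.mem_closedBall_self zero_le_one)
    rw [zero_smul, add_zero] at hres0
    have hcomm : ∀ x, Matrix.toLin' (spectralProjection Γ (A + t • E))
        (Matrix.toLin' (A + t • E) x) = Matrix.toLin' (A + t • E)
          (Matrix.toLin' (spectralProjection Γ (A + t • E)) x) :=
      LinearMap.congr_fun hsel.commute
    have hinner := spectrum_inter_inner hunion.subset hΓ hΓe (hnorm t ht)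
    have houter := spectrum_inter_outer hunion.subset hΓ hΓe (hnorm t ht)
    have hdiff := spectrum_diff_inner hunion.subset hΓ hΓe (hnorm t ht)
    refine ⟨?_, ?_, ?_, ?_, ?_, ?_, ?_, ?_, ?_, ?_⟩
    · apply Matrix.toLin'.injective
      rw [Matrix.toLin'_mul]
      exact hsel.isIdempotentElem
    · apply Matrix.toLin'.injective
      rw [Matrix.toLin'_mul, Matrix.toLin'_mul]
      exact hsel.commute
    · rw [rank_spectralProjection Γ (hres t ht), rank_spectralProjection Γ hres0]
      exact eigenvalueCount_inner_eq_of_separated hunion.subset hΓ hΓe hE.le ht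
    · rintro _ ⟨y, rfl⟩
      exact ⟨Matrix.toLin' (A + t • E) y, hcomm y⟩
    · intro x hx
      rw [LinearMap.mem_ker] at hx ⊢
      rw [hcomm, hx, map_zero]
    · rw [hsel.spectrum_restrict_range, hsel.spectrum_restrict_ker, Set.inter_union_sdiff,
        spectrum_toLin']
    · rw [hsel.spectrum_restrict_range, spectrum_toLin']
    · exact hinner ▸ Set.inter_subset_right
    · rw [hsel.spectrum_restrict_ker, spectrum_toLin', hdiff]
    · exact houter ▸ Set.inter_subset_right
  · intro E hE
    refine ⟨fun t ht => eigenvalueCount_eq_of_separated hunion.subset hc hce hdisj hε.le hE.le ht,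
      fun S hS hSc h0 path hpath hspec => ?_⟩
    -- the path runs in the disjoint union of two closed sets, hence in one of them
    have hcover : path '' S ⊆ Δ ∪ Δe := by
      rintro _ ⟨t, ht, rfl⟩
      exact hunion ▸ spectrum_add_subset_pseudospectrum
        (norm_smul_le_of_mem_closedBall hE.le (hS ht)) (hspec t ht)
    have hsplit := isPreconnected_iff_subset_of_disjoint_closed.1
      (hSc.isPreconnected.image path hpath) Δ Δe hc.isClosed hce.isClosed hcover
      (by rw [hdisj.inter_eq, Set.inter_empty])
    constructor
    · intro h t ht
      rcases hsplit with hs | hs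
      · exact hs ⟨t, ht, rfl⟩
      · exact absurd (hs ⟨0, h0, rfl⟩) (Set.disjoint_left.1 hdisj h)
    · intro h t ht
      rcases hsplit with hs | hs
      · exact absurd h (Set.disjoint_left.1 hdisj (hs ⟨0, h0, rfl⟩))
      · exact hs ⟨t, ht, rfl⟩
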